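/- Let $B$ be a unital $C^*$-algebra and let $A_1, A_2$ be unital $C^*$-algebras, each containing $B$ as a unital $C^*$-subalgebra, with conditional expectations $E_i : A_i \to B$ ($i=1,2$) whose KSGNS representations are faithful, i.e. for every nonzero $a \in A_i$ there is $x \in A_i$ with $E_i(x^*a^*ax) \neq 0$. Let $(A,E) = (A_1,E_1) * (A_2,E_2)$ be the reduced amalgamated free product over $B$: with $L^2(A_i,E_i)$ the Hilbert $B$-module completion of $A_i$ for $\langle a,a'\rangle = E_i(a^*a')$ and $L^2(A_i,E_i)^\circ$ the orthogonal complement of $\widehat{1}B$ in it, $A$ is the $C^*$-algebra of adjointable operators generated by the canonical left actions of $A_1$ and $A_2$ on the Hilbert $B$-module $$M = \xi B \oplus \bigoplus_{n \ge 1}\ \bigoplus_{\iota_1 \ne \iota_2 \ne \cdots \ne \iota_n} L^2(A_{\iota_1},E_{\iota_1})^\circ \otimes_B \cdots \otimes_B L^2(A_{\iota_n},E_{\iota_n})^\circ , \qquad \xi = 1_B,$$ and $E(a) = \langle \xi, a\xi\rangle$. Regard $A_1, A_2$ as subalgebras of $A$, put $A_i^\circ = \ker E_i$, and let $$\Lambda_B^1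 = \operatorname{span}\Big(\bigcup_{k=0}^\infty A_1^\circ (A_2^\circ A_1^\circ)^k\Big) \subset A$$ be the linear span of the alternating words that begin and end with a letter from $A_1^\circ$. Suppose that there are unitaries $u_1 \in A_1$ and $u_2, u_2' \in A_2$ with $$E_1(u_1) = E_2(u_2) = E_2(u_2') = E(u_2 u_2'^*) = 0 .$$ Then for every $x \in \Lambda_B^1$, the element $0$ lies in the norm closure of the convex hull of $\{\, u x u^* : u \in A \text{ unitary} \,\}$. -/

import Mathlib

/-! # Reduced amalgamated free products of C⋆-algebras -/

noncomputable section

namespace AmalgFree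

open scoped Pointwise

set_option linter.unusedSectionVars false

/-- A right module `V` over a unital C⋆-algebra `B` with a `B`-valued semi-inner product
(conjugate linear in the first variable, `B`-linear in the second one). The right action of `B`
is an action of `Bᵐᵒᵖ`. -/
class PreHilbertModule (B V : Type*) [CStarAlgebra B] [PartialOrder B] [StarOrderedRing B]
    [AddCommGroup V] [Module ℂ V] [Module Bᵐᵒᵖ V] where
  /-- the semi-inner product -/
  ip : V → V → B
  ip_add_right : ∀ x y z, ip x (y + z) = ip x y + ip x z
  ip_smul_right : ∀ (c : ℂ) (x y : V), ip x (c • y) = c • ip x y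
  ip_op_smul_right : ∀ (b : B) (x y : V), ip x (MulOpposite.op b • y) = ip x y * b
  star_ip : ∀ x y, star (ip x y) = ip y x
  ip_self_nonneg : ∀ x, 0 ≤ ip x x

/-- A right Hilbert `B`-module: it is complete for the norm `‖x‖ = ‖⟨x, x⟩‖ ^ (1/2)`. -/
class HilbertModule (B M : Type*) [CStarAlgebra B] [PartialOrder B] [StarOrderedRing B]
    [NormedAddCommGroup M] [NormedSpace ℂ M] [Module Bᵐᵒᵖ M]
    extends PreHilbertModule B M, CompleteSpace M where
  norm_eq : ∀ x : M, ‖x‖ = √‖ip x x‖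

section pre

open PreHilbertModule

variable {B V : Type*} [CStarAlgebra B] [PartialOrder B] [StarOrderedRing B]
    [AddCommGroup V] [Module ℂ V] [Module Bᵐᵒᵖ V] [PreHilbertModule B V]

local notation "⟪" x "," y "⟫" => PreHilbertModule.ip (B := B) x y

lemma ip_add_left (x y z : V) : ⟪x + y, z⟫ = ⟪x, z⟫ + ⟪y, z⟫ := by
  rw [← star_ip, ip_add_right, star_add, star_ip, star_ip]

lemma ip_smul_left (c : ℂ) (x y : V) : ⟪c • x, y⟫ = star c • ⟪x, y⟫ := by
  rw [← star_ip, ip_smul_right, star_smul, star_ip]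

lemma ip_op_smul_left (b : B) (x y : V) : ⟪MulOpposite.op b • x, y⟫ = star b * ⟪x, y⟫ := by
  rw [← star_ip, ip_op_smul_right, star_mul, star_ip]

/-- The semi-inner product as a sesquilinear map. -/
def ipₛₗ : V →ₗ⋆[ℂ] V →ₗ[ℂ] B where
  toFun x :=
    { toFun := fun y => ⟪x, y⟫
      map_add' := ip_add_right x
      map_smul' := fun c y => ip_smul_right c x y }
  map_add' x y := by ext z; exact ip_add_left x y z
  map_smul' c x := by ext z; exact ip_smul_left c x z

lemma ip_sub_left (x y z : V) : ⟪x - y, z⟫ = ⟪x, z⟫ - ⟪y, z⟫ := by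
  have := LinearMap.congr_fun (map_sub (ipₛₗ (B := B) (V := V)) x y) z
  exact this

lemma ip_sub_right (x y z : V) : ⟪x, y - z⟫ = ⟪x, y⟫ - ⟪x, z⟫ :=
  map_sub (ipₛₗ (B := B) x) y z

lemma ip_zero_right (x : V) : ⟪x, 0⟫ = 0 := map_zero (ipₛₗ (B := B) x)

lemma ip_cauchy (x y : V) : ‖⟪x, y⟫‖ ≤ √‖⟪x, x⟫‖ * √‖⟪y, y⟫‖ := by
  have key : ∀ K : ℝ, ‖⟪x, x⟫‖ < K → ‖⟪x, y⟫‖ ^ 2 ≤ K * ‖⟪y, y⟫‖ := by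
    intro K hK
    have hK0 : 0 < K := lt_of_le_of_lt (norm_nonneg _) hK
    have h1 := ip_self_nonneg (B := B) (((K : ℝ) : ℂ) • y - MulOpposite.op ⟪x, y⟫ • x)
    have h2 : star ⟪x, y⟫ * ⟪x, x⟫ * ⟪x, y⟫ ≤ K • (star ⟪x, y⟫ * ⟪x, y⟫) :=
      (CStarAlgebra.star_left_conjugate_le_norm_smul (a := ⟪x, y⟫) (b := ⟪x, x⟫)
        (star_ip x x)).trans
        (smul_le_smul_of_nonneg_right hK.le (star_mul_self_nonneg _))
    have h3 : star ⟪x, y⟫ * ⟪x, y⟫ ≤ K • ⟪y, y⟫ := by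
      have h4 : (0 : B) ≤ K • (K • ⟪y, y⟫ - star ⟪x, y⟫ * ⟪x, y⟫) := by
        refine h1.trans ?_
        have : ⟪((K : ℝ) : ℂ) • y - MulOpposite.op ⟪x, y⟫ • x,
            ((K : ℝ) : ℂ) • y - MulOpposite.op ⟪x, y⟫ • x⟫ =
            K • K • ⟪y, y⟫ - (2 * K) • (star ⟪x, y⟫ * ⟪x, y⟫)
              + star ⟪x, y⟫ * ⟪x, x⟫ * ⟪x, y⟫ := by
          simp only [ip_sub_left, ip_sub_right, ip_smul_left, ip_smul_right, ip_op_smul_left,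
            ip_op_smul_right, Complex.star_def, Complex.conj_ofReal, star_ip]
          simp only [Complex.coe_smul, smul_mul_assoc, two_mul, add_smul, mul_assoc,
            sub_mul, smul_sub]
          abel
        rw [this, smul_sub, two_mul, add_smul]
        have h5 := add_le_add_right h2 (K • K • ⟪y, y⟫ - (K • (star ⟪x, y⟫ * ⟪x, y⟫)
          + K • (star ⟪x, y⟫ * ⟪x, y⟫)))
        refine h5.trans (le_of_eq ?_)
        abel
      have h6 := smul_nonneg (inv_nonneg.mpr hK0.le) h4
      rw [smul_smul, inv_mul_cancel₀ hK0.ne', one_smul] at h6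
      exact sub_nonneg.mp h6
    have h7 := CStarAlgebra.norm_le_norm_of_nonneg_of_le (star_mul_self_nonneg _) h3
    rw [CStarRing.norm_star_mul_self, norm_smul, Real.norm_of_nonneg hK0.le] at h7
    rw [pow_two]; exact h7
  rw [← Real.sqrt_mul (norm_nonneg _)]
  refine Real.le_sqrt_of_sq_le ?_
  refine le_of_forall_pos_le_add fun ε hε => ?_
  have hd : (0 : ℝ) < ‖⟪y, y⟫‖ + 1 := by positivity
  have := key (‖⟪x, x⟫‖ + ε / (‖⟪y, y⟫‖ + 1)) (by linarith [div_pos hε hd])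
  refine this.trans ?_
  rw [add_mul]
  have h8 : ε / (‖⟪y, y⟫‖ + 1) * ‖⟪y, y⟫‖ ≤ ε := by
    rw [div_mul_eq_mul_div, div_le_iff₀ hd]
    nlinarith [norm_nonneg ⟪y, y⟫]
  linarith

variable (B V) in
/-- The seminorm `‖⟨x, x⟩‖ ^ (1/2)` of a semi-inner product module. -/
abbrev preNorm : Norm V := ⟨fun x => √‖⟪x, x⟫‖⟩

variable (B V) in
lemma seminormedCore :
    let _ := preNorm B V
    SeminormedSpace.Core ℂ V := by
  let _ := preNorm B V
  refine ⟨fun x => Real.sqrt_nonneg _, fun c x => ?_, fun x y => ?_⟩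
  · change √‖⟪c • x, c • x⟫‖ = ‖c‖ * √‖⟪x, x⟫‖
    rw [ip_smul_left, ip_smul_right, norm_smul, norm_smul, norm_star, ← mul_assoc,
      Real.sqrt_mul (by positivity), Real.sqrt_mul_self (norm_nonneg _)]
  · change √‖⟪x + y, x + y⟫‖ ≤ √‖⟪x, x⟫‖ + √‖⟪y, y⟫‖
    refine Real.sqrt_le_left (by positivity) |>.mpr ?_
    rw [ip_add_left, ip_add_right, ip_add_right]
    have h1 := ip_cauchy (B := B) x y
    have h2 := ip_cauchy (B := B) y x
    have hx := Real.sq_sqrt (norm_nonneg ⟪x, x⟫)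
    have hy := Real.sq_sqrt (norm_nonneg ⟪y, y⟫)
    have h3 := norm_add_le (⟪x, x⟫ + ⟪x, y⟫) (⟪y, x⟫ + ⟪y, y⟫)
    have h4 := norm_add_le ⟪x, x⟫ ⟪x, y⟫
    have h5 := norm_add_le ⟪y, x⟫ ⟪y, y⟫
    nlinarith

end pre

/-! ### Adjointable operators -/

section adjointable

variable (B M : Type*) [CStarAlgebra B] [PartialOrder B] [StarOrderedRing B]
    [NormedAddCommGroup M] [NormedSpace ℂ M] [Module Bᵐᵒᵖ M] [HilbertModule B M]

local notation "⟪" x "," y "⟫" => PreHilbertModule.ip (B := B) x y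

/-- The algebra `𝓛(M)` of all adjointable operators on the right Hilbert `B`-module `M`. (Such
operators are automatically `B`-linear.) -/
def Adjointable : Subalgebra ℂ (M →L[ℂ] M) where
  carrier := {T | ∃ S : M →L[ℂ] M, ∀ x y : M, ⟪T x, y⟫ = ⟪x, S y⟫}
  mul_mem' := by
    rintro T T' ⟨S, hS⟩ ⟨S', hS'⟩
    exact ⟨S' * S, fun x y => by simp [hS, hS']⟩
  add_mem' := by
    rintro T T' ⟨S, hS⟩ ⟨S', hS'⟩
    exact ⟨S + S', fun x y => by
      simp [hS, hS', ip_add_left, PreHilbertModule.ip_add_right]⟩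
  algebraMap_mem' c := ⟨algebraMap ℂ _ (star c), fun x y => by
      simp [Algebra.algebraMap_eq_smul_one, ip_smul_left, PreHilbertModule.ip_smul_right]⟩

variable {B M}

lemma norm_sq_eq (x : M) : ‖x‖ ^ 2 = ‖⟪x, x⟫‖ := by
  rw [HilbertModule.norm_eq (B := B), Real.sq_sqrt (norm_nonneg _)]

lemma norm_ip_le (x y : M) : ‖⟪x, y⟫‖ ≤ ‖x‖ * ‖y‖ := by
  rw [HilbertModule.norm_eq (B := B) x, HilbertModule.norm_eq (B := B) y]
  exact ip_cauchy x y

lemma ext_ip {x y : M} (h : ∀ z : M, ⟪z, x⟫ = ⟪z, y⟫) : x = y := by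
  have h1 : ‖x - y‖ ^ 2 = 0 := by
    rw [norm_sq_eq (B := B), ip_sub_right, h, sub_self, norm_zero]
  rwa [sq_eq_zero_iff, norm_eq_zero, sub_eq_zero] at h1

namespace Adjointable

/-- The adjoint of an adjointable operator, as a bounded operator. -/
def adj (T : Adjointable B M) : M →L[ℂ] M := T.2.choose

lemma ip_adj (T : Adjointable B M) (x y : M) : ⟪T.1 x, y⟫ = ⟪x, adj T y⟫ := T.2.choose_spec x y

lemma adj_ip (T : Adjointable B M) (x y : M) : ⟪adj T x, y⟫ = ⟪x, T.1 y⟫ := by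
  rw [← PreHilbertModule.star_ip, ← ip_adj, PreHilbertModule.star_ip]

lemma adj_eq {T : Adjointable B M} {S : M →L[ℂ] M} (h : ∀ x y : M, ⟪T.1 x, y⟫ = ⟪x, S y⟫) :
    adj T = S := by
  ext y
  exact ext_ip (B := B) fun z => by rw [← ip_adj, h]

instance : Star (Adjointable B M) := ⟨fun T => ⟨adj T, T.1, adj_ip T⟩⟩

lemma coe_star (T : Adjointable B M) : (star T).1 = adj T := rfl

/-- The defining property of the adjoint `star T` of `T`. -/
lemma ip_star (T : Adjointable B M) (x y : M) : ⟪T.1 x, y⟫ = ⟪x, (star T).1 y⟫ := ip_adj T x y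

instance : StarRing (Adjointable B M) where
  star_involutive T := Subtype.ext (adj_eq (adj_ip T))
  star_mul T S := Subtype.ext (adj_eq fun x y => by
    change ⟪T.1 (S.1 x), y⟫ = ⟪x, adj S (adj T y)⟫
    rw [ip_adj, ip_adj])
  star_add T S := Subtype.ext (adj_eq fun x y => by
    change ⟪T.1 x + S.1 x, y⟫ = ⟪x, adj T y + adj S y⟫
    rw [ip_add_left, PreHilbertModule.ip_add_right, ip_adj, ip_adj])

instance : StarModule ℂ (Adjointable B M) where
  star_smul c T := Subtype.ext (adj_eq fun x y => by
    change ⟪c • T.1 x, y⟫ = ⟪x, star c • adj T y⟫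
    rw [ip_smul_left, PreHilbertModule.ip_smul_right, ip_adj])

instance : CStarRing (Adjointable B M) where
  norm_mul_self_le T := by
    change ‖T.1‖ * ‖T.1‖ ≤ ‖star T * T‖
    have h : ‖T.1‖ ≤ √‖star T * T‖ := by
      refine ContinuousLinearMap.opNorm_le_bound _ (Real.sqrt_nonneg _) fun x => ?_
      refine abs_le_of_sq_le_sq' ?_ (by positivity) |>.2
      rw [mul_pow, Real.sq_sqrt (norm_nonneg (star T * T)), norm_sq_eq (B := B), ip_star]
      refine (norm_ip_le _ _).trans ?_
      have := (star T * T).1.le_opNorm x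
      have h2 : ‖(star T).1 (T.1 x)‖ ≤ ‖star T * T‖ * ‖x‖ := this
      nlinarith [norm_nonneg x]
    calc ‖T.1‖ * ‖T.1‖ ≤ √‖star T * T‖ * √‖star T * T‖ := by gcongr
      _ = _ := Real.mul_self_sqrt (norm_nonneg _)

lemma norm_adj (T : Adjointable B M) : ‖adj T‖ = ‖T.1‖ := norm_star T

instance : CompleteSpace (Adjointable B M) := by
  suffices h : IsClosed {T : M →L[ℂ] M | T ∈ Adjointable B M} from
    IsClosed.completeSpace_coe (hs := h)
  refine IsSeqClosed.isClosed fun T T' hT hlim => ?_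
  have hc : CauchySeq fun n => adj ⟨T n, hT n⟩ := by
    have h1 := hlim.cauchySeq
    rw [Metric.cauchySeq_iff'] at h1 ⊢
    intro ε hε
    obtain ⟨N, hN⟩ := h1 ε hε
    refine ⟨N, fun n hn => ?_⟩
    have h2 := hN n hn
    rw [dist_eq_norm] at h2 ⊢
    have h3 : ‖adj ⟨T n, hT n⟩ - adj ⟨T N, hT N⟩‖ = ‖T n - T N‖ := by
      have := norm_star (⟨T n, hT n⟩ - ⟨T N, hT N⟩ : Adjointable B M)
      rwa [star_sub] at this
    rwa [h3]
  obtain ⟨S, hS⟩ := cauchySeq_tendsto_of_complete hc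
  refine ⟨S, fun x y => ?_⟩
  have h1 : Filter.Tendsto (fun n => ⟪T n x, y⟫) Filter.atTop (nhds ⟪T' x, y⟫) := by
    refine tendsto_iff_norm_sub_tendsto_zero.mpr ?_
    have h2 : Filter.Tendsto (fun n => ‖T n - T'‖ * ‖x‖ * ‖y‖) Filter.atTop (nhds 0) := by
      have := (tendsto_iff_norm_sub_tendsto_zero.mp hlim).mul_const (‖x‖) |>.mul_const ‖y‖
      simpa using this
    refine squeeze_zero (fun _ => norm_nonneg _) (fun n => ?_) h2
    rw [← ip_sub_left]
    refine (norm_ip_le _ _).trans ?_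
    gcongr
    exact (T n - T').le_opNorm x
  have h2 : Filter.Tendsto (fun n => ⟪T n x, y⟫) Filter.atTop (nhds ⟪x, S y⟫) := by
    refine tendsto_iff_norm_sub_tendsto_zero.mpr ?_
    have h2 : Filter.Tendsto (fun n => ‖x‖ * (‖adj ⟨T n, hT n⟩ - S‖ * ‖y‖)) Filter.atTop
        (nhds 0) := by
      have := ((tendsto_iff_norm_sub_tendsto_zero.mp hS).mul_const (‖y‖)).const_mul ‖x‖
      simpa using this
    refine squeeze_zero (fun _ => norm_nonneg _) (fun n => ?_) h2
    rw [ip_adj ⟨T n, hT n⟩, ← ip_sub_right]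
    refine (norm_ip_le _ _).trans ?_
    gcongr
    exact (adj ⟨T n, hT n⟩ - S).le_opNorm y
  exact tendsto_nhds_unique h1 h2

instance : CStarAlgebra (Adjointable B M) where

end Adjointable
end adjointable

/-! ### Separated completion of a semi-inner product module -/

section completion

open UniformSpace

/-- A semi-inner product module that carries the seminorm `‖x‖ = ‖⟨x, x⟩‖ ^ (1/2)`. -/
class SeminormedModule (B V : Type*) [CStarAlgebra B] [PartialOrder B] [StarOrderedRing B]
    [SeminormedAddCommGroup V] [NormedSpace ℂ V] [Module Bᵐᵒᵖ V]
    extends PreHilbertModule B V where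
  norm_eq : ∀ x : V, ‖x‖ = √‖ip x x‖

variable (B V : Type*) [CStarAlgebra B] [PartialOrder B] [StarOrderedRing B]
    [SeminormedAddCommGroup V] [NormedSpace ℂ V] [Module Bᵐᵒᵖ V] [SeminormedModule B V]

local notation "⟪" x "," y "⟫" => PreHilbertModule.ip (B := B) x y

variable {V} in
lemma norm_op_smul_le (b : B) (x : V) : ‖MulOpposite.op b • x‖ ≤ ‖b‖ * ‖x‖ := by
  rw [SeminormedModule.norm_eq (B := B), SeminormedModule.norm_eq (B := B) x,
    ip_op_smul_left, PreHilbertModule.ip_op_smul_right]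
  refine Real.sqrt_le_left (by positivity) |>.mpr ?_
  rw [mul_pow, Real.sq_sqrt (norm_nonneg _)]
  refine (norm_mul_le _ _).trans ?_
  rw [norm_star, sq, mul_assoc]
  gcongr
  rw [mul_comm]
  exact norm_mul_le _ _

lemma uniformContinuousConstSMul_op : UniformContinuousConstSMul Bᵐᵒᵖ V where
  uniformContinuous_const_smul b := by
    refine AddMonoidHomClass.uniformContinuous_of_bound
      (DistribSMul.toAddMonoidHom V b) ‖b.unop‖ fun x => ?_
    exact norm_op_smul_le B b.unop x

/-- The separated completion of the semi-inner product module `V`, a right Hilbert `B`-module. -/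
def HilbertCompletion (_B V : Type*) [SeminormedAddCommGroup V] : Type _ := Completion V

namespace HilbertCompletion

instance : NormedAddCommGroup (HilbertCompletion B V) :=
  inferInstanceAs (NormedAddCommGroup (Completion V))

instance : NormedSpace ℂ (HilbertCompletion B V) :=
  inferInstanceAs (NormedSpace ℂ (Completion V))

instance : CompleteSpace (HilbertCompletion B V) :=
  inferInstanceAs (CompleteSpace (Completion V))

instance : Module Bᵐᵒᵖ (HilbertCompletion B V) :=
  haveI := uniformContinuousConstSMul_op B V
  inferInstanceAs (Module Bᵐᵒᵖ (Completion V))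

variable {V} in
/-- The canonical map of `V` to its completion. -/
def mk (x : V) : HilbertCompletion B V := (x : Completion V)

instance : ContinuousConstSMul Bᵐᵒᵖ (HilbertCompletion B V) :=
  haveI := uniformContinuousConstSMul_op B V
  inferInstanceAs (ContinuousConstSMul Bᵐᵒᵖ (Completion V))

variable {B V}

lemma mk_op_smul (b : B) (x : V) : mk B (MulOpposite.op b • x) = MulOpposite.op b • mk B x :=
  haveI := uniformContinuousConstSMul_op B V
  Completion.coe_smul (MulOpposite.op b) x

lemma mk_add (x y : V) : mk B (x + y) = mk B x + mk B y := Completion.coe_add x y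

lemma mk_smul (c : ℂ) (x : V) : mk B (c • x) = c • mk B x := Completion.coe_smul c x

lemma continuous_mk : Continuous (mk B : V → HilbertCompletion B V) := Completion.continuous_coe V

lemma norm_mk (x : V) : ‖mk B x‖ = ‖x‖ := Completion.norm_coe x

lemma denseRange_mk : DenseRange (mk B : V → HilbertCompletion B V) := Completion.denseRange_coe

lemma continuous_ip_pre : Continuous fun p : V × V => ⟪p.1, p.2⟫ := by
  have h : ∀ x y : V, ‖ipₛₗ (B := B) x y‖ ≤ 1 * ‖x‖ * ‖y‖ := fun x y => by
    rw [one_mul, SeminormedModule.norm_eq (B := B) x, SeminormedModule.norm_eq (B := B) y]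
    exact ip_cauchy x y
  let g : V →L⋆[ℂ] V →L[ℂ] B := LinearMap.mkContinuous₂ (ipₛₗ (B := B) (V := V)) 1 h
  change Continuous fun p : V × V => g p.1 p.2
  fun_prop

/-- The inner product on the completion: the continuous extension of the one on `V`. -/
def ipc : HilbertCompletion B V → HilbertCompletion B V → B :=
  Function.curry <| (Completion.isDenseInducing_coe.prodMap Completion.isDenseInducing_coe).extend
    fun p : V × V => ⟪p.1, p.2⟫

lemma ipc_mk (x y : V) : ipc (mk B x) (mk B y) = ⟪x, y⟫ :=
  (Completion.isDenseInducing_coe.prodMap Completion.isDenseInducing_coe).extend_eq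
    (continuous_ip_pre (B := B) (V := V)) (x, y)

lemma continuous_ipc :
    Continuous fun p : HilbertCompletion B V × HilbertCompletion B V => ipc (B := B) p.1 p.2 := by
  let f : V →+ V →+ B :=
    { toFun := fun x => (ipₛₗ (B := B) x).toAddMonoidHom
      map_zero' := by ext y; simp
      map_add' := fun x y => by ext z; simp }
  have hf : Continuous fun p : V × V => f p.1 p.2 := continuous_ip_pre
  exact (Completion.isDenseInducing_toCompl V).extend_Z_bilin
    (Completion.isDenseInducing_toCompl V) hf

lemma continuous_ipc' {α : Type*} [TopologicalSpace α] {f g : α → HilbertCompletion B V}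
    (hf : Continuous f) (hg : Continuous g) : Continuous fun a => ipc (B := B) (f a) (g a) :=
  continuous_ipc.comp (hf.prodMk hg)

lemma induction {p : HilbertCompletion B V → Prop} (x : HilbertCompletion B V)
    (hc : IsClosed {x | p x}) (h : ∀ v : V, p (mk B v)) : p x :=
  Completion.induction_on x hc h

lemma ipc_add_right (x y z : HilbertCompletion B V) :
    ipc (B := B) x (y + z) = ipc x y + ipc x z := by
  induction x using induction with
  | hc => exact isClosed_eq (continuous_ipc' continuous_id continuous_const)
           ((continuous_ipc' continuous_id continuous_const).add
            (continuous_ipc' continuous_id continuous_const))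
  | h x =>
  induction y using induction with
  | hc => exact isClosed_eq (continuous_ipc' continuous_const
           (continuous_id.add continuous_const))
           ((continuous_ipc' continuous_const continuous_id).add continuous_const)
  | h y =>
  induction z using induction with
  | hc => exact isClosed_eq (continuous_ipc' continuous_const
           (continuous_const.add continuous_id))
           (continuous_const.add (continuous_ipc' continuous_const continuous_id))
  | h z => rw [← mk_add, ipc_mk, ipc_mk, ipc_mk, PreHilbertModule.ip_add_right]

lemma ipc_smul_right (c : ℂ) (x y : HilbertCompletion B V) :
    ipc (B := B) x (c • y) = c • ipc x y := by
  have hc : Continuous fun b : B => c • b := continuous_const_smul c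
  have hc' : Continuous fun b : HilbertCompletion B V => c • b := continuous_const_smul c
  induction x using induction with
  | hc => exact isClosed_eq (continuous_ipc' continuous_id continuous_const)
           (hc.comp (continuous_ipc' continuous_id continuous_const))
  | h x =>
  induction y using induction with
  | hc => exact isClosed_eq (continuous_ipc' continuous_const hc')
           (hc.comp (continuous_ipc' continuous_const continuous_id))
  | h y => rw [← mk_smul (B := B), ipc_mk, ipc_mk, PreHilbertModule.ip_smul_right]

lemma ipc_op_smul_right (b : B) (x y : HilbertCompletion B V) :
    ipc (B := B) x (MulOpposite.op b • y) = ipc x y * b := by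
  have hc : Continuous fun c : B => c * b := continuous_id.mul continuous_const
  have hc' : Continuous fun y : HilbertCompletion B V => MulOpposite.op b • y :=
    continuous_const_smul _
  induction x using induction with
  | hc => exact isClosed_eq (continuous_ipc' continuous_id continuous_const)
           (hc.comp (continuous_ipc' continuous_id continuous_const))
  | h x =>
  induction y using induction with
  | hc => exact isClosed_eq (continuous_ipc' continuous_const hc')
           (hc.comp (continuous_ipc' continuous_const continuous_id))
  | h y => rw [← mk_op_smul, ipc_mk, ipc_mk, PreHilbertModule.ip_op_smul_right]

lemma star_ipc (x y : HilbertCompletion B V) : star (ipc (B := B) x y) = ipc y x := by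
  induction x using induction with
  | hc => exact isClosed_eq (continuous_ipc' continuous_id continuous_const).star
           (continuous_ipc' continuous_const continuous_id)
  | h x =>
  induction y using induction with
  | hc => exact isClosed_eq (continuous_ipc' continuous_const continuous_id).star
           (continuous_ipc' continuous_id continuous_const)
  | h y => rw [ipc_mk, ipc_mk, PreHilbertModule.star_ip]

lemma ipc_self_nonneg (x : HilbertCompletion B V) : 0 ≤ ipc (B := B) x x := by
  induction x using induction with
  | hc => exact isClosed_le continuous_const (continuous_ipc' continuous_id continuous_id)
  | h x => rw [ipc_mk]; exact PreHilbertModule.ip_self_nonneg x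

lemma norm_eq_ipc (x : HilbertCompletion B V) : ‖x‖ = √‖ipc (B := B) x x‖ := by
  induction x using induction with
  | hc => exact isClosed_eq continuous_norm (continuous_ipc' continuous_id continuous_id).norm.sqrt
  | h x => rw [ipc_mk, norm_mk (B := B), SeminormedModule.norm_eq (B := B)]

instance : HilbertModule B (HilbertCompletion B V) where
  ip := ipc
  ip_add_right := ipc_add_right
  ip_smul_right := ipc_smul_right
  ip_op_smul_right := ipc_op_smul_right
  star_ip := star_ipc
  ip_self_nonneg := ipc_self_nonneg
  norm_eq := norm_eq_ipc

lemma ip_mk (x y : V) : ⟪mk B x, mk B y⟫ = ⟪x, y⟫ := ipc_mk x y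

end HilbertCompletion

end completion

/-! ### Conditional expectations -/

/-- A conditional expectation `E : A → B` for the unital inclusion `incl : B → A`: a positive linear
`B`-bimodule map which restricts to the identity on `B`. (The last condition makes `incl`
injective, so that it identifies `B` with a unital C⋆-subalgebra of `A`.) -/
structure CondExp {A B : Type*} [CStarAlgebra A] [CStarAlgebra B] [PartialOrder B]
    [StarOrderedRing B] (incl : B →⋆ₐ[ℂ] A) where
  /-- the underlying linear map -/
  toLinearMap : A →ₗ[ℂ] B
  map_incl : ∀ b, toLinearMap (incl b) = b
  map_incl_mul : ∀ b a, toLinearMap (incl b * a) = b * toLinearMap a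
  map_mul_incl : ∀ a b, toLinearMap (a * incl b) = toLinearMap a * b
  nonneg : ∀ a, 0 ≤ toLinearMap (star a * a)

lemma star_eq_of_polar {B : Type*} [CStarAlgebra B] {x y : B} (h₁ : IsSelfAdjoint (x + y))
    (h₂ : IsSelfAdjoint (Complex.I • x - Complex.I • y)) : star x = y := by
  have e₁ : star x + star y = x + y := by rw [← star_add]; exact h₁
  have e₂ : Complex.I • (star y - star x) = Complex.I • (x - y) := by
    have := h₂.star_eq
    rw [star_sub, star_smul, star_smul] at this
    simp only [Complex.star_def, Complex.conj_I, neg_smul] at this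
    rw [smul_sub, smul_sub, ← this]
    abel
  have e₃ : star y - star x = x - y := by
    have := congrArg (fun t => (Complex.I)⁻¹ • t) e₂
    simpa [smul_smul] using this
  have e₄ : (2 : ℂ) • star x = (2 : ℂ) • y := by
    rw [two_smul, two_smul]
    calc star x + star x = (star x + star y) - (star y - star x) := by abel
      _ = (x + y) - (x - y) := by rw [e₁, e₃]
      _ = y + y := by abel
  have := congrArg (fun t => (2 : ℂ)⁻¹ • t) e₄
  simpa [smul_smul] using this

namespace CondExp

variable {A B : Type*} [CStarAlgebra A] [CStarAlgebra B] [PartialOrder B]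
    [StarOrderedRing B] {incl : B →⋆ₐ[ℂ] A}

instance : CoeFun (CondExp incl) (fun _ => A → B) := ⟨fun E => E.toLinearMap⟩

/-- The KSGNS representation of `E` is faithful: for every `a ≠ 0` there is an `x` with
`E (x⋆ a⋆ a x) ≠ 0`. -/
def Nondegenerate (E : CondExp incl) : Prop :=
  ∀ a : A, a ≠ 0 → ∃ x : A, E (star x * star a * a * x) ≠ 0

lemma map_star (E : CondExp incl) (a : A) : E (star a) = star (E a) := by
  have hs : ∀ c : A, IsSelfAdjoint (E (star c * c)) := fun c => IsSelfAdjoint.of_nonneg (E.nonneg c)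
  symm
  refine star_eq_of_polar ?_ ?_
  · have h := ((hs (1 + a)).sub (hs 1)).sub (hs a)
    convert h using 1
    simp only [← map_sub, ← map_add]
    congr 1
    simp only [star_add, star_one]
    noncomm_ring
  · have h := ((hs (1 + Complex.I • a)).sub (hs 1)).sub (hs (Complex.I • a))
    convert h using 1
    simp only [← map_sub, ← map_smul]
    congr 1
    simp only [star_add, star_one, star_smul, Complex.star_def, Complex.conj_I, add_mul, mul_add,
      one_mul, mul_one, neg_smul]
    abel

lemma map_one (E : CondExp incl) : E 1 = 1 := by
  have := E.map_incl 1
  rwa [_root_.map_one] at this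

end CondExp

/-! ### Positive kernels -/

section posker

variable {n B : Type*} [Fintype n] [CStarAlgebra B] [PartialOrder B] [StarOrderedRing B]

/-- Positivity of a matrix with entries in `B`. -/
def PosKer (C : n → n → B) : Prop := ∀ b : n → B, 0 ≤ ∑ r, ∑ s, star (b r) * C r s * b s

lemma PosKer.star_eq {C : n → n → B} (hC : PosKer C) (r s : n) : star (C r s) = C s r := by
  classical
  have hs : ∀ b : n → B, IsSelfAdjoint (∑ r, ∑ s, star (b r) * C r s * b s) :=
    fun b => IsSelfAdjoint.of_nonneg (hC b)
  have key : ∀ c : ℂ, ∑ i, ∑ j, star ((Pi.single r (1 : B) + Pi.single s (c • (1 : B)) : n → B) i)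
      * C i j * (Pi.single r (1 : B) + Pi.single s (c • (1 : B)) : n → B) j =
      C r r + c • C r s + star c • C s r + (star c * c) • C s s := by
    intro c
    simp [Pi.single_apply, add_mul, mul_add, Finset.sum_add_distrib, apply_ite star, ite_mul,
      mul_ite, smul_smul, mul_comm c]
    abel
  have key0 : ∀ r, IsSelfAdjoint (C r r) := fun r => by
    have h := hs (Pi.single r 1)
    simpa [Pi.single_apply, apply_ite star, ite_mul, mul_ite] using h
  refine star_eq_of_polar ?_ ?_
  · have h := hs (Pi.single r (1 : B) + Pi.single s ((1 : ℂ) • (1 : B)))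
    rw [key] at h
    have h := (h.sub (key0 r)).sub (key0 s)
    convert h using 1
    simp only [star_one, one_smul, mul_one]
    abel
  · have h := hs (Pi.single r (1 : B) + Pi.single s (Complex.I • (1 : B)))
    rw [key] at h
    have h := (h.sub (key0 r)).sub (key0 s)
    convert h using 1
    simp only [Complex.star_def, Complex.conj_I, neg_mul, Complex.I_mul_I, neg_neg, one_smul,
      neg_smul]
    abel

lemma exists_star_mul_self {D : Type*} [CStarAlgebra D] [PartialOrder D] [StarOrderedRing D]
    {X : D} (hX : IsSelfAdjoint X)
    (h : ∀ Y Z : D, star Z * X * Z = -(star Y * Y) → Y = 0) : ∃ Y, X = star Y * Y := by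
  have hp : X⁺ - X⁻ = X := CFC.posPart_sub_negPart X hX
  have hpn : X⁺ * X⁻ = 0 := CFC.posPart_mul_negPart X
  have hns : IsSelfAdjoint (X⁻) := IsSelfAdjoint.of_nonneg (CFC.negPart_nonneg X)
  have h3 : star (X⁻) * X * X⁻ = - (X⁻ * X⁻ * X⁻) := by
    have h2 : X * X⁻ = -(X⁻ * X⁻) := by
      calc X * X⁻ = (X⁺ - X⁻) * X⁻ := by rw [hp]
        _ = _ := by rw [sub_mul, hpn, zero_sub]
    rw [hns.star_eq, mul_assoc, h2]
    noncomm_ring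
  have h4 : 0 ≤ X⁻ * X⁻ * X⁻ := by
    have := star_left_conjugate_nonneg (CFC.negPart_nonneg X) (X⁻)
    rwa [hns.star_eq] at this
  obtain ⟨Y, hY⟩ := CStarAlgebra.nonneg_iff_eq_star_mul_self.mp h4
  have h6 : Y = 0 := h Y (X⁻) (by rw [h3, hY])
  have h7 : X⁻ * X⁻ * X⁻ = 0 := by rw [hY, h6]; simp
  have h8 : X⁻ * X⁻ = 0 := by
    have : star (X⁻ * X⁻) * (X⁻ * X⁻) = 0 := by
      rw [star_mul, hns.star_eq, ← mul_assoc, h7, zero_mul]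
    exact CStarRing.star_mul_self_eq_zero_iff _ |>.mp this
  have h9 : X⁻ = 0 := by
    have : star (X⁻) * (X⁻) = 0 := by rw [hns.star_eq, h8]
    exact CStarRing.star_mul_self_eq_zero_iff _ |>.mp this
  rw [← hp, h9, sub_zero]
  exact CStarAlgebra.nonneg_iff_eq_star_mul_self.mp (CFC.posPart_nonneg X)

lemma PosKer.exists_factor {C : n → n → B} (hC : PosKer C) :
    ∃ T : n → n → B, ∀ r s, C r s = ∑ k, star (T k r) * T k s := by
  classical
  let X : CStarMatrix n n B := CStarMatrix.ofMatrix (Matrix.of C)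
  have hXa : ∀ r s, X r s = C r s := fun _ _ => rfl
  have hX : IsSelfAdjoint X := by
    ext r s
    rw [CStarMatrix.star_apply, hXa, hXa, hC.star_eq]
  obtain ⟨Y, hY⟩ := exists_star_mul_self hX fun Y Z hYZ => by
    have h5 : ∀ k, (star Y * Y) k k = 0 := by
      intro k
      refine le_antisymm ?_ ?_
      · have h6 := hC (fun r => Z r k)
        have h7 : (star (Z) * X * Z) k k = ∑ r, ∑ s, star (Z r k) * C r s * Z s k := by
          rw [CStarMatrix.mul_apply, Finset.sum_comm]
          refine Finset.sum_congr rfl fun s _ => ?_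
          rw [CStarMatrix.mul_apply, Finset.sum_mul]
          rfl
        rw [← h7, hYZ, CStarMatrix.neg_apply] at h6
        exact neg_nonneg.mp h6
      · rw [CStarMatrix.mul_apply]
        exact Finset.sum_nonneg fun r _ => star_mul_self_nonneg (Y r k)
    ext r k
    have h7 : ∑ j, star (Y j k) * Y j k = 0 := by
      have := h5 k
      rwa [CStarMatrix.mul_apply] at this
    rw [Finset.sum_eq_zero_iff_of_nonneg
      (fun r _ => star_mul_self_nonneg (Y r k))] at h7
    have h8 : star (Y r k) * Y r k = 0 := h7 r (Finset.mem_univ r)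
    exact CStarRing.star_mul_self_eq_zero_iff _ |>.mp h8
  refine ⟨fun r s => Y r s, fun r s => ?_⟩
  rw [← hXa, hY, CStarMatrix.mul_apply]
  rfl

variable {A : Type*} [CStarAlgebra A] {incl : B →⋆ₐ[ℂ] A}

lemma PosKer.condExp {C : n → n → B} (hC : PosKer C) (E : CondExp incl) (a : n → A) :
    PosKer fun r s => E (star (a r) * incl (C r s) * a s) := by
  intro b
  obtain ⟨T, hT⟩ := hC.exists_factor
  have h : ∑ r, ∑ s, star (b r) * E (star (a r) * incl (C r s) * a s) * b s =
      ∑ k, E (star (∑ r, incl (T k r) * a r * incl (b r)) *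
        (∑ r, incl (T k r) * a r * incl (b r))) := by
    simp only [star_sum, Finset.sum_mul_sum, map_sum]
    rw [Finset.sum_comm' (t' := Finset.univ) (s' := fun _ => Finset.univ) (by simp)]
    conv_rhs => rw [Finset.sum_comm]
    rw [Finset.sum_comm]
    refine Finset.sum_congr rfl fun r _ => ?_
    conv_rhs => rw [Finset.sum_comm]
    refine Finset.sum_congr rfl fun s _ => ?_
    rw [← E.map_incl_mul, ← E.map_mul_incl, hT, ← map_sum]
    congr 1
    simp only [map_sum, Finset.mul_sum, Finset.sum_mul, map_mul, star_mul, map_star, mul_assoc]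
  rw [h]
  exact Finset.sum_nonneg fun k _ => E.nonneg _

end posker

/-! ### Words and their Gram kernel -/

section words

variable {I : Type*} [DecidableEq I] {B : Type*} [CStarAlgebra B] [PartialOrder B]
  [StarOrderedRing B] {A : I → Type*} [∀ i, CStarAlgebra (A i)] {incl : ∀ i, B →⋆ₐ[ℂ] A i}

/-- The letter `x`, seen in `A i`; it is `0` if `x` belongs to some `A j` with `j ≠ i`. -/
def comp (i : I) (x : Σ i, A i) : A i := if h : x.1 = i then h ▸ x.2 else 0

@[simp] lemma comp_self (i : I) (a : A i) : comp i ⟨i, a⟩ = a := by simp [comp]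

lemma comp_fst (x : Σ i, A i) : comp x.1 x = x.2 := comp_self x.1 x.2

lemma comp_ne {i : I} {x : Σ i, A i} (h : x.1 ≠ i) : comp i x = 0 := by simp [comp, h]

variable (E : ∀ i, CondExp (incl i))

/-- `gram E p q c` is the inner product `⟨a₁ ⊗ ⋯ ⊗ aₙ, c • (a'₁ ⊗ ⋯ ⊗ a'ₘ)⟩` in the orthogonal direct
sum of the interior tensor products over `B`. It is `E (aₙ⋆ ⋯ E (a₂⋆ E (a₁⋆ c a'₁) a'₂) ⋯ a'ₙ)` if
the letters `aₖ` and `a'ₖ` belong to the same algebra for all `k` and `n = m`, and `0` otherwise. -/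
def gram : List (Σ i, A i) → List (Σ i, A i) → B → B
  | [], [], c => c
  | x :: p, y :: q, c => gram p q (E y.1 (star (comp y.1 x) * incl y.1 c * y.2))
  | [], _ :: _, _ => 0
  | _ :: _, [], _ => 0

lemma gram_add (p q : List (Σ i, A i)) (c d : B) :
    gram E p q (c + d) = gram E p q c + gram E p q d := by
  induction p generalizing q c d with
  | nil => cases q <;> simp [gram]
  | cons x p ih => cases q <;> simp [gram, ih, mul_add, add_mul]

lemma gram_smul (p q : List (Σ i, A i)) (z : ℂ) (c : B) :
    gram E p q (z • c) = z • gram E p q c := by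
  induction p generalizing q c with
  | nil => cases q <;> simp [gram]
  | cons x p ih => cases q <;> simp [gram, ih]

lemma gram_zero (p q : List (Σ i, A i)) : gram E p q 0 = 0 := by
  simpa using gram_smul E p q 0 0

lemma gram_cons_ne (x y : Σ i, A i) (p q : List (Σ i, A i)) (c : B) (h : x.1 ≠ y.1) :
    gram E (x :: p) (y :: q) c = 0 := by
  simp [gram, comp_ne h, gram_zero]

lemma star_gram (p q : List (Σ i, A i)) (c : B) :
    star (gram E p q c) = gram E q p (star c) := by
  induction p generalizing q c with
  | nil => cases q <;> simp [gram]
  | cons x p ih =>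
    cases q with
    | nil => simp [gram]
    | cons y q =>
      by_cases h : x.1 = y.1
      · obtain ⟨i, a⟩ := x
        obtain ⟨j, b⟩ := y
        obtain rfl : i = j := h
        simp only [gram, ih, comp_self, ← CondExp.map_star, star_mul, star_star, map_star, mul_assoc]
      · rw [gram_cons_ne E _ _ _ _ _ h, gram_cons_ne E _ _ _ _ _ (Ne.symm h), star_zero]

/-- The first letter of a word, seen in `A i`. -/
def headComp (i : I) : List (Σ i, A i) → A i
  | [] => 0
  | x :: _ => comp i x

lemma gram_posKer {n : Type*} [Fintype n] (N : ℕ) (p : n → List (Σ i, A i))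
    (hp : ∀ r, (p r).length ≤ N) (C : n → n → B) (hC : PosKer C) :
    PosKer fun r s => gram E (p r) (p s) (C r s) := by
  classical
  induction N generalizing p C with
  | zero =>
    have h0 : ∀ r, p r = [] := fun r => List.length_eq_zero_iff.mp (Nat.le_zero.mp (hp r))
    intro b
    simpa [h0, gram] using hC b
  | succ N ih =>
    let S : Finset I := Finset.univ.biUnion fun r => ((p r).map Sigma.fst).toFinset
    have key : ∀ r s, gram E (p r) (p s) (C r s) =
        (if p r = [] then 1 else 0) * C r s * (if p s = [] then 1 else 0) +
        ∑ i ∈ S, gram E (p r).tail (p s).tail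
          (E i (star (headComp i (p r)) * incl i (C r s) * headComp i (p s))) := by
      intro r s
      have hs : ∀ x q, p s = x :: q → x.1 ∈ S := fun x q h => by
        simp only [S, Finset.mem_biUnion]
        exact ⟨s, Finset.mem_univ _, by simp [h]⟩
      generalize p s = q at hs ⊢
      generalize p r = p'
      cases p' with
      | nil => cases q <;> simp [gram, headComp, gram_zero]
      | cons x p' =>
        cases q with
        | nil => simp [gram, headComp, gram_zero]
        | cons y q =>
          rw [Finset.sum_eq_single y.1]
          · simp [gram, headComp, comp_fst]
          · intro i _ hi
            simp [headComp, comp_ne hi.symm, gram_zero]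
          · intro h
            exact absurd (hs y q rfl) h
    intro b
    have h1 : 0 ≤ ∑ r, ∑ s, star (b r) *
        ((if p r = [] then 1 else 0) * C r s * (if p s = [] then 1 else 0)) * b s := by
      have := hC fun r => if p r = [] then b r else 0
      refine this.trans_eq (Finset.sum_congr rfl fun r _ => Finset.sum_congr rfl fun s _ => ?_)
      split_ifs <;> simp
    have h2 : ∀ i ∈ S, 0 ≤ ∑ r, ∑ s, star (b r) * gram E (p r).tail (p s).tail
          (E i (star (headComp i (p r)) * incl i (C r s) * headComp i (p s))) * b s :=
      fun i _ => ih (fun r => (p r).tail) (fun r => by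
        have := hp r
        rw [List.length_tail]
        omega) _ (hC.condExp (E i) fun r => headComp i (p r)) b
    have h3 := add_nonneg h1 (Finset.sum_nonneg h2)
    convert h3 using 1
    rw [Finset.sum_comm (s := S), ← Finset.sum_add_distrib]
    refine Finset.sum_congr rfl fun r _ => ?_
    rw [Finset.sum_comm (s := S), ← Finset.sum_add_distrib]
    refine Finset.sum_congr rfl fun s _ => ?_
    beta_reduce
    rw [key, mul_add, add_mul, Finset.mul_sum, Finset.sum_mul]

/-- The reduced words: words `a₁ a₂ ⋯ aₙ` (`n ≥ 0`) with letters `aₖ ∈ A iₖ`, `E (aₖ) = 0` and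
`i₁ ≠ i₂ ≠ ⋯ ≠ iₙ`. -/
structure RWord where
  /-- the letters of the word -/
  letters : List (Σ i, A i)
  expect_eq_zero : ∀ x ∈ letters, E x.1 x.2 = 0
  isChain : letters.IsChain fun x y => x.1 ≠ y.1

namespace RWord

variable {E}

/-- The empty word. -/
def nil : RWord E := ⟨[], by simp, by simp⟩

/-- The word `p` does not start with a letter from `A i`. -/
def NotStart (i : I) (p : RWord E) : Prop := ∀ x ∈ p.letters.head?, x.1 ≠ i

/-- The word `a p`. -/
def cons (i : I) (a : A i) (ha : E i a = 0) (p : RWord E) (hp : NotStart i p) : RWord E where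
  letters := ⟨i, a⟩ :: p.letters
  expect_eq_zero x hx := by
    rcases List.mem_cons.mp hx with rfl | hx
    · exact ha
    · exact p.expect_eq_zero x hx
  isChain := List.isChain_cons.mpr ⟨fun y hy => (hp y hy).symm, p.isChain⟩

/-- Left multiplication of the first letter of a nonempty word by `b ∈ B`. -/
def lmul (b : B) : RWord E → RWord E
  | ⟨[], h, h'⟩ => ⟨[], h, h'⟩
  | ⟨x :: p, h, h'⟩ => ⟨⟨x.1, incl x.1 b * x.2⟩ :: p, by
      intro y hy
      rcases List.mem_cons.mp hy with rfl | hy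
      · simp [(E x.1).map_incl_mul, h x (by simp)]
      · exact h y (by simp [hy]), by
      rw [List.isChain_cons] at h' ⊢
      exact h'⟩

/-- The first part of the decomposition `p = a p'` of a word, with `a ∈ A i` and `p'` not starting
with a letter of `A i`: `a` is the first letter of `p` if it belongs to `A i`, and `a = 1`
otherwise. -/
def coef (i : I) : RWord E → A i
  | ⟨[], _, _⟩ => 1
  | ⟨x :: _, _, _⟩ => if x.1 = i then comp i x else 1

/-- The second part `p'` of the decomposition `p = a p'` of a word with `a = coef i p`. -/
def rest (i : I) : RWord E → RWord E
  | ⟨[], h, h'⟩ => ⟨[], h, h'⟩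
  | ⟨x :: p, h, h'⟩ => if x.1 = i then
      ⟨p, fun y hy => h y (List.mem_cons_of_mem _ hy), (List.isChain_cons.mp h').2⟩
      else ⟨x :: p, h, h'⟩

lemma notStart_rest (i : I) (p : RWord E) : NotStart i (rest i p) := by
  obtain ⟨_ | ⟨x, p⟩, h, h'⟩ := p
  · simp [rest, NotStart]
  · intro y hy
    by_cases hx : x.1 = i
    · rw [rest, if_pos hx] at hy
      rw [← hx]
      exact ((List.isChain_cons.mp h').1 y hy).symm
    · rw [rest, if_neg hx] at hy
      simp only [List.head?_cons, Option.mem_some_iff] at hy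
      rwa [← hy]

end RWord

/-! ### The module spanned by the elementary tensors -/

lemma sum_gram_nonneg (v : RWord E →₀ B) :
    0 ≤ v.sum fun p b => v.sum fun q c => star b * gram E p.letters q.letters 1 * c := by
  classical
  obtain ⟨s, hs⟩ : ∃ s : Finset (RWord E), s = v.support := ⟨_, rfl⟩
  have h := gram_posKer E (n := s) (s.sup fun p => p.letters.length) (fun r => r.1.letters)
    (fun r => Finset.le_sup (f := fun p : RWord E => p.letters.length) r.2) (fun _ _ => 1)
    (fun b => by
      have : ∑ r, ∑ s, star (b r) * 1 * b s = star (∑ r, b r) * ∑ r, b r := by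
        simp [star_sum, Finset.sum_mul_sum]
      rw [this]
      exact star_mul_self_nonneg _) (fun r => v r.1)
  refine h.trans_eq ?_
  unfold Finsupp.sum
  rw [← hs, ← Finset.sum_coe_sort s]
  exact Finset.sum_congr rfl fun r _ =>
    Finset.sum_coe_sort s fun p => star (v r) * gram E r.1.letters p.letters 1 * v p

/-- The free right `B`-module on the reduced words. The basis element of the word `a₁ a₂ ⋯ aₙ` is
the elementary tensor `a₁ ⊗ a₂ ⊗ ⋯ ⊗ aₙ`, and `1 ∈ B` for `n = 0`. -/
def PreM : Type _ := RWord E →₀ B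

instance : AddCommGroup (PreM E) := inferInstanceAs (AddCommGroup (RWord E →₀ B))
instance : Module ℂ (PreM E) := inferInstanceAs (Module ℂ (RWord E →₀ B))
instance : Module Bᵐᵒᵖ (PreM E) := inferInstanceAs (Module Bᵐᵒᵖ (RWord E →₀ B))

namespace PreM

variable {E}

/-- The element `a₁ ⊗ a₂ ⊗ ⋯ ⊗ aₙ b`. -/
def single (p : RWord E) (b : B) : PreM E := Finsupp.single p b

lemma induction {P : PreM E → Prop} (v : PreM E) (h0 : P 0)
    (hadd : ∀ v w, P v → P w → P (v + w)) (hs : ∀ p b, P (single p b)) : P v :=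
  Finsupp.induction_linear v h0 hadd hs

lemma single_add (p : RWord E) (b c : B) : single p (b + c) = single p b + single p c :=
  Finsupp.single_add p b c

lemma op_smul_single (p : RWord E) (b c : B) :
    MulOpposite.op c • single p b = single p (b * c) :=
  Finsupp.smul_single (MulOpposite.op c) p b

/-- The sesquilinear form of a `B`-valued kernel on the reduced words. -/
def form (K : RWord E → RWord E → B) (v w : PreM E) : B :=
  Finsupp.sum (M := B) v fun p b => Finsupp.sum (M := B) w fun q c => star b * K p q * c

section

variable (K : RWord E → RWord E → B)

lemma form_single (p q : RWord E) (b c : B) :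
    form K (single p b) (single q c) = star b * K p q * c := by
  simp [form, single, Finsupp.sum_single_index]

lemma form_add_right (v w w' : PreM E) : form K v (w + w') = form K v w + form K v w' := by
  refine Eq.trans ?_ (Finsupp.sum_add (f := (v : RWord E →₀ B)))
  refine Finsupp.sum_congr fun p _ => ?_
  exact Finsupp.sum_add_index' (by simp) (by simp [mul_add])

lemma form_add_left (v v' w : PreM E) : form K (v + v') w = form K v w + form K v' w := by
  refine Finsupp.sum_add_index' (f := (v : RWord E →₀ B)) (g := v') (fun p => ?_) fun p b c => ?_
  · simp only [star_zero, zero_mul]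
    exact Finset.sum_const_zero
  · refine Eq.trans ?_ (Finsupp.sum_add (f := (w : RWord E →₀ B)))
    exact Finsupp.sum_congr fun q _ => by rw [star_add, add_mul, add_mul]

lemma form_zero_right (v : PreM E) : form K v 0 = 0 := by
  have := form_add_right K v 0 0
  simpa using this

lemma form_zero_left (v : PreM E) : form K 0 v = 0 := by
  have := form_add_left K 0 0 v
  simpa using this

lemma form_op_smul_right (b : B) (v w : PreM E) :
    form K v (MulOpposite.op b • w) = form K v w * b := by
  induction w using induction with
  | h0 => rw [smul_zero, form_zero_right, zero_mul]
  | hadd w w' h h' => rw [smul_add, form_add_right, form_add_right, add_mul, h, h']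
  | hs q c =>
  induction v using induction with
  | h0 => rw [form_zero_left, form_zero_left, zero_mul]
  | hadd v v' h h' => rw [form_add_left, form_add_left, add_mul, h, h']
  | hs p d => rw [op_smul_single, form_single, form_single, ← mul_assoc]

lemma form_op_smul_left (b : B) (v w : PreM E) :
    form K (MulOpposite.op b • v) w = star b * form K v w := by
  induction w using induction with
  | h0 => rw [form_zero_right, form_zero_right, mul_zero]
  | hadd w w' h h' => rw [form_add_right, form_add_right, mul_add, h, h']
  | hs q c =>
  induction v using induction with
  | h0 => rw [smul_zero, form_zero_left, mul_zero]
  | hadd v v' h h' => rw [smul_add, form_add_left, form_add_left, mul_add, h, h']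
  | hs p d => rw [op_smul_single, form_single, form_single, star_mul]; simp only [mul_assoc]

lemma smul_eq_op_smul (z : ℂ) (v : PreM E) : z • v = MulOpposite.op (z • (1 : B)) • v := by
  induction v using induction with
  | h0 => rw [smul_zero, smul_zero]
  | hadd v w h h' => rw [smul_add, smul_add, h, h']
  | hs p b =>
    rw [op_smul_single, mul_smul_comm, mul_one]
    exact Finsupp.smul_single z p b

lemma form_congr {K K' : RWord E → RWord E → B} (h : ∀ p q, K p q = K' p q) (v w : PreM E) :
    form K v w = form K' v w := by
  rw [funext₂ h]

lemma star_form (v w : PreM E) : star (form K v w) = form (fun p q => star (K q p)) w v := by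
  induction w using induction with
  | h0 => rw [form_zero_right, form_zero_left, star_zero]
  | hadd w w' h h' => rw [form_add_right, form_add_left, star_add, h, h']
  | hs q c =>
  induction v using induction with
  | h0 => rw [form_zero_right, form_zero_left, star_zero]
  | hadd v v' h h' => rw [form_add_right, form_add_left, star_add, h, h']
  | hs p d => rw [form_single, form_single]; simp only [star_mul, star_star, mul_assoc]

end

/-- The inner product of elementary tensors in the interior tensor products over `B`; elementary
tensors belonging to different sequences of indices are orthogonal. -/
instance : PreHilbertModule B (PreM E) where
  ip := form fun p q => gram E p.letters q.letters 1
  ip_add_right := form_add_right _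
  ip_op_smul_right := form_op_smul_right _
  ip_smul_right z v w := by rw [smul_eq_op_smul, form_op_smul_right, mul_smul_comm, mul_one]
  star_ip v w := by
    rw [star_form]
    exact form_congr (fun p q => by rw [star_gram, star_one]) _ _
  ip_self_nonneg v := sum_gram_nonneg E v

local notation "⟪" x "," y "⟫" => PreHilbertModule.ip (B := B) x y

lemma ip_single (p q : RWord E) (b c : B) :
    ⟪single p b, single q c⟫ = star b * gram E p.letters q.letters 1 * c :=
  form_single (fun p q => gram E p.letters q.letters 1) p q b c

instance : SeminormedAddCommGroup (PreM E) :=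
  let _ := preNorm B (PreM E)
  SeminormedAddCommGroup.ofCore (seminormedCore B (PreM E))

lemma norm_eq (v : PreM E) : ‖v‖ = √‖⟪v, v⟫‖ := rfl

instance : NormedSpace ℂ (PreM E) where
  norm_smul_le z v := ((seminormedCore B (PreM E)).norm_smul z v).le

instance : SeminormedModule B (PreM E) where
  norm_eq := norm_eq

/-! ### The left action of `A i` -/

/-- The left action of `b ∈ B` on an elementary tensor. -/
def lact (b : B) (p : RWord E) : PreM E :=
  match p.letters with
  | [] => single p b
  | _ :: _ => single (p.lmul b) 1

/-- For a reduced word `p = a₁ ⋯ aₙ` not starting with a letter of `A i` and `a ∈ A i`, this is the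
image of `a ⊗ (a₁ ⊗ ⋯ ⊗ aₙ)` under the isomorphism of `L²(A i, E i) ⊗ M(i)` with the whole module,
i.e. `(a - E a) ⊗ a₁ ⊗ ⋯ ⊗ aₙ + (E a) a₁ ⊗ ⋯ ⊗ aₙ`. -/
def tens (i : I) (a : A i) (p : RWord E) (hp : p.NotStart i) : PreM E :=
  single (RWord.cons i (a - incl i (E i a)) (by rw [map_sub, (E i).map_incl, sub_self]) p hp) 1
    + lact (E i a) p

/-- The left action of `a ∈ A i` on elementary tensors: an elementary tensor is of the form `c ⊗ p'`
with `c ∈ A i` and `p'` not starting with a letter of `A i`, and `a` acts on it by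
`c ⊗ p' ↦ (a c) ⊗ p'`. -/
def lamWord (i : I) (a : A i) (p : RWord E) : PreM E :=
  tens i (a * p.coef i) (p.rest i) (p.notStart_rest i)

/-- The left action of `a ∈ A i`, extended to a right `B`-linear map. -/
def lam (i : I) (a : A i) : PreM E →ₗ[ℂ] PreM E :=
  Finsupp.lsum (M := B) ℂ fun p : RWord E =>
    { toFun := fun b => MulOpposite.op b • lamWord i a p
      map_add' := fun b c => by rw [MulOpposite.op_add, add_smul]
      map_smul' := fun z b => by
        rw [RingHom.id_apply, smul_eq_op_smul (E := E), smul_smul, ← MulOpposite.op_mul, mul_smul_comm,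
          mul_one] }

lemma lam_single (i : I) (a : A i) (p : RWord E) (b : B) :
    lam i a (single p b) = MulOpposite.op b • lamWord i a p := by
  exact Finsupp.lsum_single (M := B) ℂ _ p b

end PreM

end words

section operators

variable {I : Type*} [DecidableEq I] {B : Type*} [CStarAlgebra B] [PartialOrder B]
  [StarOrderedRing B] {A : I → Type*} [∀ i, CStarAlgebra (A i)] {incl : ∀ i, B →⋆ₐ[ℂ] A i}
  {E : ∀ i, CondExp (incl i)}

namespace PreM

local notation "⟪" x "," y "⟫" => PreHilbertModule.ip (B := B) x y

open PreHilbertModule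

lemma ip_lact (p q : RWord E) (b : B) : ⟪single p 1, lact b q⟫ = gram E p.letters q.letters b := by
  obtain ⟨_ | ⟨x, q⟩, h, h'⟩ := q
  · obtain ⟨_ | ⟨y, p⟩, g, g'⟩ := p <;> simp [lact, ip_single, gram]
  · obtain ⟨_ | ⟨y, p⟩, g, g'⟩ := p
    · simp [lact, ip_single, gram, RWord.lmul]
    · simp [lact, ip_single, gram, RWord.lmul, mul_assoc]

lemma ip_lact_lact (p q : RWord E) (b c : B) :
    ⟪lact b p, lact c q⟫ = gram E p.letters q.letters (star b * c) := by
  obtain ⟨_ | ⟨x, p⟩, h, h'⟩ := p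
  · obtain ⟨_ | ⟨y, q⟩, g, g'⟩ := q <;> simp [lact, ip_single, gram, RWord.lmul]
  · change ⟪single (RWord.lmul b ⟨x :: p, h, h'⟩) 1, lact c q⟫ = _
    rw [ip_lact]
    obtain ⟨_ | ⟨y, q⟩, g, g'⟩ := q
    · simp [gram, RWord.lmul]
    · by_cases hxy : x.1 = y.1
      · obtain ⟨i, a⟩ := x
        obtain ⟨j, d⟩ := y
        obtain rfl : i = j := hxy
        simp [gram, RWord.lmul, mul_assoc, map_star]
      · have hxy' : (⟨x.1, incl x.1 b * x.2⟩ : Σ i, A i).1 ≠ y.1 := hxy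
        simp only [RWord.lmul]
        rw [gram_cons_ne E _ _ _ _ _ hxy, gram_cons_ne E _ _ _ _ _ hxy']

lemma gram_cons_notStart {i : I} (a : A i) (l : List (Σ i, A i)) (q : RWord E)
    (hq : q.NotStart i) (c : B) : gram E (⟨i, a⟩ :: l) q.letters c = 0 := by
  obtain ⟨_ | ⟨y, q⟩, g, g'⟩ := q
  · simp [gram]
  · exact gram_cons_ne E _ _ _ _ _ (hq y (by simp)).symm

lemma gram_notStart_cons {i : I} (a : A i) (l : List (Σ i, A i)) (q : RWord E)
    (hq : q.NotStart i) (c : B) : gram E q.letters (⟨i, a⟩ :: l) c = 0 := by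
  rw [← star_star (gram E _ _ c), star_gram, gram_cons_notStart a l q hq, star_zero]

lemma E_center {i : I} (a d : A i) : E i (star (a - incl i (E i a)) * (d - incl i (E i d))) =
    E i (star a * d) - star (E i a) * E i d := by
  rw [star_sub, ← map_star, sub_mul, mul_sub, mul_sub, map_sub, map_sub, map_sub,
    (E i).map_mul_incl, (E i).map_incl_mul, (E i).map_incl_mul, (E i).map_incl, (E i).map_star]
  abel

lemma ip_tens_tens (i : I) (a d : A i) (p q : RWord E) (hp : p.NotStart i) (hq : q.NotStart i) :
    ⟪tens i a p hp, tens i d q hq⟫ = gram E p.letters q.letters (E i (star a * d)) := by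
  unfold tens
  rw [ip_add_left, ip_add_right, ip_add_right, ip_lact_lact, ip_lact, ← star_ip _ (lact (E i a) p),
    ip_lact, ip_single]
  simp only [RWord.cons]
  rw [gram_cons_notStart _ _ _ hq, gram_cons_notStart _ _ _ hp]
  simp only [gram, comp_self, map_one, mul_one, star_one, one_mul, E_center, star_zero, add_zero,
    zero_add]
  rw [← gram_add, sub_add_cancel]

lemma ip_single_tens (i : I) (p q : RWord E) (d : A i) (hq : q.NotStart i) :
    ⟪single p 1, tens i d q hq⟫ =
      gram E (p.rest i).letters q.letters (E i (star (p.coef i) * d)) := by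
  unfold tens
  rw [ip_add_right, ip_lact, ip_single]
  simp only [star_one, one_mul, mul_one]
  obtain ⟨_ | ⟨x, p⟩, h, h'⟩ := p
  · simp [RWord.cons, gram, RWord.rest, RWord.coef]
  · by_cases hx : x.1 = i
    · obtain ⟨j, a⟩ := x
      obtain rfl : j = i := hx
      rw [gram_cons_notStart a p q hq, add_zero]
      simp only [RWord.cons, RWord.rest, RWord.coef, gram, comp_self, if_true, map_one, mul_one]
      have ha : E j a = 0 := h ⟨j, a⟩ (by simp)
      have := E_center (E := E) a d
      rw [ha, map_zero, sub_zero, star_zero, zero_mul, sub_zero] at this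
      rw [this]
    · simp only [RWord.cons, RWord.rest, RWord.coef, if_neg hx, star_one, one_mul]
      rw [gram_cons_ne _ _ _ _ _ _ hx, zero_add]

/-- The kernel of the sesquilinear form `⟨v, a w⟩`. -/
def ker (i : I) (a : A i) (p q : RWord E) : B :=
  gram E (p.rest i).letters (q.rest i).letters (E i (star (p.coef i) * a * q.coef i))

lemma ip_single_lamWord (i : I) (a : A i) (p q : RWord E) :
    ⟪single p 1, lamWord i a q⟫ = ker i a p q := by
  unfold lamWord ker
  rw [ip_single_tens, mul_assoc]

lemma ip_lamWord_lamWord (i : I) (a d : A i) (p q : RWord E) :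
    ⟪lamWord i a p, lamWord i d q⟫ = ker i (star a * d) p q := by
  unfold lamWord ker
  rw [ip_tens_tens, star_mul]
  simp only [mul_assoc]

lemma single_eq (p : RWord E) (b : B) : single p b = MulOpposite.op b • single p 1 := by
  rw [op_smul_single, one_mul]

lemma ip_lam (i : I) (a : A i) (v w : PreM E) : ⟪v, lam i a w⟫ = form (ker i a) v w := by
  induction w using induction with
  | h0 => rw [map_zero, ip_zero_right, form_zero_right]
  | hadd w w' h h' => rw [map_add, ip_add_right, form_add_right, h, h']
  | hs q c =>
  induction v using induction with
  | h0 => exact (form_zero_left _ _).trans (form_zero_left _ _).symm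
  | hadd v v' h h' => rw [ip_add_left, form_add_left, h, h']
  | hs p b =>
    rw [lam_single, single_eq p, ip_op_smul_left, ip_op_smul_right, ip_single_lamWord, ← single_eq,
      form_single, mul_assoc]

lemma ip_lam_lam (i : I) (a d : A i) (v w : PreM E) :
    ⟪lam i a v, lam i d w⟫ = form (ker i (star a * d)) v w := by
  induction w using induction with
  | h0 => rw [map_zero, ip_zero_right, form_zero_right]
  | hadd w w' h h' => rw [map_add, ip_add_right, form_add_right, h, h']
  | hs q c =>
  induction v using induction with
  | h0 => rw [map_zero, form_zero_left]; exact form_zero_left _ _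
  | hadd v v' h h' => rw [map_add, ip_add_left, form_add_left, h, h']
  | hs p b =>
    rw [lam_single, lam_single, ip_op_smul_left, ip_op_smul_right, ip_lamWord_lamWord, form_single,
      mul_assoc]

lemma ker_one (i : I) (p q : RWord E) : ker i 1 p q = gram E p.letters q.letters 1 := by
  unfold ker
  rw [mul_one]
  obtain ⟨_ | ⟨x, p⟩, h, h'⟩ := p
  · obtain ⟨_ | ⟨y, q⟩, g, g'⟩ := q
    · simp [RWord.rest, RWord.coef, gram, (E i).map_one]
    · by_cases hy : y.1 = i
      · have : E i (comp i y) = 0 := by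
          subst hy
          rw [comp_fst]
          exact g y (by simp)
        simp [RWord.rest, RWord.coef, gram, hy, this, gram_zero]
      · simp [RWord.rest, RWord.coef, gram, hy]
  · by_cases hx : x.1 = i
    · subst hx
      have hx0 : E x.1 x.2 = 0 := h x (by simp)
      obtain ⟨_ | ⟨y, q⟩, g, g'⟩ := q
      · simp [RWord.rest, RWord.coef, gram, comp_fst, (E x.1).map_star, hx0, gram_zero]
      · by_cases hy : y.1 = x.1
        · obtain ⟨i, a⟩ := x
          obtain ⟨j, b⟩ := y
          obtain rfl : j = i := hy
          simp [RWord.rest, RWord.coef, gram]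
        · rw [gram_cons_ne _ _ _ _ _ _ (Ne.symm hy)]
          simp [RWord.rest, RWord.coef, hy, comp_fst, (E x.1).map_star, hx0, gram_zero]
    · obtain ⟨_ | ⟨y, q⟩, g, g'⟩ := q
      · simp [RWord.rest, RWord.coef, gram, hx]
      · by_cases hy : y.1 = i
        · subst hy
          have hy0 : E y.1 y.2 = 0 := g y (by simp)
          rw [gram_cons_ne _ _ _ _ _ _ hx]
          simp [RWord.rest, RWord.coef, hx, comp_fst, hy0, gram_zero]
        · simp [RWord.rest, RWord.coef, hx, hy, (E i).map_one]

lemma ip_lam_one (i : I) (v w : PreM E) : ⟪v, lam i 1 w⟫ = ⟪v, w⟫ := by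
  rw [ip_lam]
  exact form_congr (ker_one i) v w

lemma star_ker (i : I) (a : A i) (p q : RWord E) : star (ker i a p q) = ker i (star a) q p := by
  unfold ker
  rw [star_gram, ← (E i).map_star]
  simp only [star_mul, star_star, mul_assoc]

lemma ip_lam_left (i : I) (a : A i) (v w : PreM E) : ⟪lam i a v, w⟫ = ⟪v, lam i (star a) w⟫ := by
  rw [← star_ip, ip_lam, ip_lam, star_form]
  exact form_congr (fun p q => star_ker i a q p) v w

lemma ip_lam_mul (i : I) (a d : A i) (v w : PreM E) :
    ⟪v, lam i (a * d) w⟫ = ⟪v, lam i a (lam i d w)⟫ := by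
  rw [← star_star a, ← ip_lam_left, ip_lam_lam, ip_lam]

lemma ip_lam_add (i : I) (a d : A i) (v w : PreM E) :
    ⟪v, lam i (a + d) w⟫ = ⟪v, lam i a w⟫ + ⟪v, lam i d w⟫ := by
  rw [ip_lam, ip_lam, ip_lam]
  induction w using induction with
  | h0 => simp only [form_zero_right, add_zero]
  | hadd w w' h h' => simp only [form_add_right, h, h']; abel
  | hs q c =>
  induction v using induction with
  | h0 => simp only [form_zero_left, add_zero]
  | hadd v v' h h' => simp only [form_add_left, h, h']; abel
  | hs p b => simp only [form_single, ker, mul_add, add_mul, map_add, gram_add]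

lemma ip_lam_smul (i : I) (z : ℂ) (a : A i) (v w : PreM E) :
    ⟪v, lam i (z • a) w⟫ = z • ⟪v, lam i a w⟫ := by
  rw [ip_lam, ip_lam]
  induction w using induction with
  | h0 => simp only [form_zero_right, smul_zero]
  | hadd w w' h h' => simp only [form_add_right, h, h', smul_add]
  | hs q c =>
  induction v using induction with
  | h0 => simp only [form_zero_left, smul_zero]
  | hadd v v' h h' => simp only [form_add_left, h, h', smul_add]
  | hs p b => simp only [form_single, ker, mul_smul_comm, smul_mul_assoc, map_smul, gram_smul]

lemma norm_lam_le (i : I) (a : A i) (v : PreM E) : ‖lam i a v‖ ≤ ‖a‖ * ‖v‖ := by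
  let _ := CStarAlgebra.spectralOrder (A i)
  have _ := CStarAlgebra.spectralOrderedRing (A i)
  have h1 : 0 ≤ algebraMap ℝ (A i) (‖a‖ ^ 2) - star a * a :=
    sub_nonneg.mpr CStarAlgebra.star_mul_le_algebraMap_norm_sq
  obtain ⟨c, hc⟩ := CStarAlgebra.nonneg_iff_eq_star_mul_self.mp h1
  have h2 : ⟪lam i a v, lam i a v⟫ + ⟪lam i c v, lam i c v⟫ = (‖a‖ ^ 2 : ℝ) • ⟪v, v⟫ := by
    rw [ip_lam_left, ip_lam_left i c, ← ip_lam_mul, ← ip_lam_mul, ← ip_lam_add, ← hc,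
      add_sub_cancel, Algebra.algebraMap_eq_smul_one, ← Complex.coe_smul, ip_lam_smul, ip_lam_one,
      Complex.coe_smul]
  have h3 : ⟪lam i a v, lam i a v⟫ ≤ (‖a‖ ^ 2 : ℝ) • ⟪v, v⟫ := by
    rw [← h2]
    exact le_add_of_nonneg_right (ip_self_nonneg _)
  have h4 := CStarAlgebra.norm_le_norm_of_nonneg_of_le (ip_self_nonneg _) h3
  rw [norm_smul, Real.norm_of_nonneg (by positivity)] at h4
  rw [norm_eq, norm_eq]
  refine Real.sqrt_le_left (by positivity) |>.mpr ?_
  rw [mul_pow, Real.sq_sqrt (norm_nonneg _)]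
  exact h4

/-- The left action of `a ∈ A i` as a bounded operator. -/
def lamCLM (i : I) (a : A i) : PreM E →L[ℂ] PreM E :=
  (lam i a).mkContinuous ‖a‖ (norm_lam_le i a)

end PreM

variable (E)

/-- The Hilbert `B`-module `M`, the free product of the modules `L²(A i, E i)`: the orthogonal direct
sum of `B` and of the interior tensor products `L²(A i₁)° ⊗ ⋯ ⊗ L²(A iₙ)°` over `B`, for all
`i₁ ≠ i₂ ≠ ⋯ ≠ iₙ`. Here `L²(A i, E i)` is the separated completion of `A i` for the inner product
`⟨a, a'⟩ = E i (a⋆ a')`, and `L²(A i)°` is the orthogonal complement of `1_{A i} B` in it, in which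
the image of the kernel of `E i` is dense. So the elementary tensors `a₁ ⊗ ⋯ ⊗ aₙ b` with `aₖ` in
the kernel of `E iₖ` and `b ∈ B` span a dense subspace of this direct sum; instead of completing
each summand and tensor factor, we complete only once, at the end. All relations between
elementary tensors, such as `a b ⊗ a' = a ⊗ b a'`, hold since the completion is separated. -/
abbrev FreeModule : Type _ := HilbertCompletion B (PreM E)

namespace FreeModule

local notation "⟪" x "," y "⟫" => PreHilbertModule.ip (B := B) x y

/-- The vector `ξ = 1_B` of `M`. -/
def vac : FreeModule E := HilbertCompletion.mk B (PreM.single RWord.nil 1)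

variable {E}

/-- The bounded operator on `M` by which `a ∈ A i` acts. -/
def lamM (i : I) (a : A i) : FreeModule E →L[ℂ] FreeModule E :=
  ContinuousLinearMap.completion (PreM.lamCLM i a)

lemma lamM_mk (i : I) (a : A i) (v : PreM E) :
    lamM i a (HilbertCompletion.mk B v) = HilbertCompletion.mk B (PreM.lam i a v) :=
  ContinuousLinearMap.completion_apply_coe (PreM.lamCLM i a) v

lemma continuous_ip {f g : FreeModule E → FreeModule E} (hf : Continuous f) (hg : Continuous g) :
    Continuous fun x => ⟪f x, g x⟫ := HilbertCompletion.continuous_ipc' hf hg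

lemma ip_lamM (i : I) (a : A i) (x y : FreeModule E) : ⟪lamM i a x, y⟫ = ⟪x, lamM i (star a) y⟫ := by
  induction x using HilbertCompletion.induction with
  | hc => exact isClosed_eq (continuous_ip (lamM i a).continuous continuous_const)
           (continuous_ip continuous_id continuous_const)
  | h v =>
  induction y using HilbertCompletion.induction with
  | hc => exact isClosed_eq (continuous_ip continuous_const continuous_id)
           (continuous_ip continuous_const (lamM i _).continuous)
  | h w =>
    rw [lamM_mk, lamM_mk, HilbertCompletion.ip_mk, HilbertCompletion.ip_mk, PreM.ip_lam_left]

lemma clm_ext {T S : FreeModule E →L[ℂ] FreeModule E}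
    (h : ∀ v w : PreM E, ⟪HilbertCompletion.mk B v, T (HilbertCompletion.mk B w)⟫ =
      ⟪HilbertCompletion.mk B v, S (HilbertCompletion.mk B w)⟫) : T = S := by
  ext y
  induction y using HilbertCompletion.induction with
  | hc => exact isClosed_eq T.continuous S.continuous
  | h w =>
  refine ext_ip (B := B) fun x => ?_
  induction x using HilbertCompletion.induction with
  | hc => exact isClosed_eq (continuous_ip continuous_id continuous_const)
           (continuous_ip continuous_id continuous_const)
  | h v => exact h v w

lemma lamM_one (i : I) : lamM (E := E) i 1 = 1 := clm_ext fun v w => by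
  rw [lamM_mk, HilbertCompletion.ip_mk, PreM.ip_lam_one]
  exact (HilbertCompletion.ip_mk v w).symm

lemma lamM_mul (i : I) (a d : A i) : lamM (E := E) i (a * d) = lamM i a * lamM i d :=
  clm_ext fun v w => by
    change _ = ⟪_, lamM i a (lamM i d _)⟫
    rw [lamM_mk, lamM_mk, lamM_mk, HilbertCompletion.ip_mk, HilbertCompletion.ip_mk,
      PreM.ip_lam_mul]

lemma lamM_add (i : I) (a d : A i) : lamM (E := E) i (a + d) = lamM i a + lamM i d :=
  clm_ext fun v w => by
    rw [add_apply, PreHilbertModule.ip_add_right]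
    rw [lamM_mk, lamM_mk, lamM_mk, HilbertCompletion.ip_mk, HilbertCompletion.ip_mk,
      HilbertCompletion.ip_mk, PreM.ip_lam_add]

lemma lamM_smul (i : I) (z : ℂ) (a : A i) : lamM (E := E) i (z • a) = z • lamM i a :=
  clm_ext fun v w => by
    rw [smul_apply, PreHilbertModule.ip_smul_right]
    rw [lamM_mk, lamM_mk, HilbertCompletion.ip_mk, HilbertCompletion.ip_mk, PreM.ip_lam_smul]

end FreeModule

open FreeModule

/-- The representation `λᵢ` of `A i` by adjointable operators on `M`. -/
def lambda (i : I) : A i →⋆ₐ[ℂ] Adjointable B (FreeModule E) where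
  toFun a := ⟨lamM i a, lamM i (star a), ip_lamM i a⟩
  map_one' := Subtype.ext (lamM_one i)
  map_mul' a d := Subtype.ext (lamM_mul i a d)
  map_zero' := Subtype.ext (by
    have := lamM_smul (E := E) i 0 0
    rwa [zero_smul, zero_smul] at this)
  map_add' a d := Subtype.ext (lamM_add i a d)
  commutes' z := Subtype.ext (by
    have h := lamM_smul (E := E) i z 1
    rw [lamM_one, ← Algebra.algebraMap_eq_smul_one, ← Algebra.algebraMap_eq_smul_one] at h
    exact h)
  map_star' a := Subtype.ext (Adjointable.adj_eq (ip_lamM i a)).symm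

/-- The reduced amalgamated free product of the `(A i, E i)`: the C⋆-algebra of adjointable operators
on `M` that is generated by the images of all `A i`. -/
def freeProdAlgebra : StarSubalgebra ℂ (Adjointable B (FreeModule E)) :=
  (StarAlgebra.adjoin ℂ (⋃ i, Set.range (lambda E i))).topologicalClosure

/-- The reduced amalgamated free product as a C⋆-algebra. -/
def ReducedFreeProduct : Type _ := freeProdAlgebra E

instance : CStarAlgebra (ReducedFreeProduct E) :=
  StarSubalgebra.cstarAlgebra (freeProdAlgebra E)
    (h_closed := StarSubalgebra.isClosed_topologicalClosure _)

namespace ReducedFreeProduct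

lemma lambda_mem (i : I) (a : A i) : lambda E i a ∈ freeProdAlgebra E :=
  StarSubalgebra.le_topologicalClosure _
    (StarAlgebra.subset_adjoin ℂ _ (Set.mem_iUnion.mpr ⟨i, a, rfl⟩))

/-- The canonical map of `A i` to the reduced amalgamated free product. -/
def of (i : I) : A i →⋆ₐ[ℂ] ReducedFreeProduct E :=
  (lambda E i).codRestrict (freeProdAlgebra E) (lambda_mem E i)

/-- The conditional expectation `E(a) = ⟨ξ, a ξ⟩` of the reduced amalgamated free product. -/
def expect (a : ReducedFreeProduct E) : B :=
  PreHilbertModule.ip (vac E) (a.1.1 (vac E))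

/-- The set `A i°`, i.e. the kernel of `E i`, in the reduced amalgamated free product. -/
def centered (i : I) : Set (ReducedFreeProduct E) := of E i '' {a | E i a = 0}

/-- The span of all alternating words with letters from `A i°` and `A j°` which begin and end with a
letter from `A i°`. -/
def altSpan (i j : I) : Submodule ℂ (ReducedFreeProduct E) :=
  Submodule.span ℂ (⋃ k : ℕ, centered E i * (centered E j * centered E i) ^ k)

end ReducedFreeProduct

end operators

end AmalgFree

end

noncomputable section

namespace AmalgFree

open scoped Pointwise

set_option linter.unusedSectionVars false

/-! ### Averaging over unitary conjugates -/

section averaging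

variable {L : Type*} [CStarAlgebra L]

/-! This is a Powers-type averaging argument, carried out with projections on the module `M`. Let
`p` and `q` be the projections of `M` onto the closed spans of the reduced words that start in `A₁`
and in `A₂`. They are orthogonal, and the empty word lies in the complement of both. A centered
letter `a ∈ A₁°` turns a word not starting in `A₁` into one that does, so `(1 - p) a (1 - p) = 0`.
Likewise `(1 - q) b (1 - q) = 0` for `b ∈ A₂°`. Because `p q = 0`, these relations multiply along
alternating words (`mul_mem_offCorner`). An alternating word beginning and ending in `A₁°` therefore
maps the complement of `p` into `p`, and by linearity so does every `x` in the span.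

Put `v n = (u₂' (u₁ u₂)ⁿ)⋆`. For `n > m` the product `(v n)⋆ v m` cancels to `u₂' (u₁ u₂)ⁿ⁻ᵐ u₂'⋆`.
Its last two letters merge into the single letter `u₂ u₂'⋆`, which is centered by assumption, so the
product is an alternating word beginning and ending in `A₂°`. It maps the complement of `q`, which
contains the range of `p`, into the range of `q`; hence `p (v n)⋆ v m p = 0`
(`compress_star_mul_eq_zero`). In other words, the ranges of the `v n * p` are pairwise orthogonal.

Now split `x = p x + (1 - p) x p`. Conjugating by `v n` and summing gives one sum with orthogonal
ranges and the adjoint of another, and each has norm at most `√N ‖x‖` by a Pythagoras estimate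
(`norm_sum_orthogonal_le`, `norm_sum_conj_le`). The average of `N` conjugates has norm at most `2
‖x‖ / √N`, which tends to `0`. The projections need not lie in the free product, but the `v n` do,
and the norm is the same in both algebras. -/

/-- The operators `T` with `(1 - p) T (1 - q) = 0`. For projections `p` and `q` these are the
operators which map the complement of the range of `q` to the range of `p`. -/
def offCorner (p q : L) : Submodule ℂ L where
  carrier := {T | (1 - p) * T * (1 - q) = 0}
  zero_mem' := by simp
  add_mem' {S T} hS hT := by
    change (1 - p) * (S + T) * (1 - q) = 0
    rw [mul_add, add_mul, hS, hT, add_zero]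
  smul_mem' c T hT := by
    change (1 - p) * (c • T) * (1 - q) = 0
    rw [mul_smul_comm, smul_mul_assoc, hT, smul_zero]

lemma mem_offCorner {p q T : L} : T ∈ offCorner p q ↔ (1 - p) * T * (1 - q) = 0 := Iff.rfl

/-- `T` sends the complement of `q'` into the range of `p'`; as `q p' = 0`, this lies in the
complement of `q`, which `S` sends into the range of `p`. This is the composition rule behind every
statement about alternating words. -/
lemma mul_mem_offCorner {p q p' q' S T : L} (h : q * p' = 0) (hS : S ∈ offCorner p q)
    (hT : T ∈ offCorner p' q') : S * T ∈ offCorner p q' := by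
  rw [mem_offCorner] at *
  have h1 : (1 - p) * S = (1 - p) * S * q := by
    rw [mul_sub, mul_one, sub_eq_zero] at hS
    exact hS
  have h2 : T * (1 - q') = p' * (T * (1 - q')) := by
    rw [mul_assoc, sub_mul, one_mul, sub_eq_zero] at hT
    exact hT
  calc (1 - p) * (S * T) * (1 - q') = (1 - p) * S * (T * (1 - q')) := by simp only [mul_assoc]
    _ = (1 - p) * S * q * (p' * (T * (1 - q'))) := by rw [← h1, ← h2]
    _ = (1 - p) * S * (q * p') * (T * (1 - q')) := by simp only [mul_assoc]
    _ = 0 := by rw [h, mul_zero, zero_mul]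

lemma star_mem_offCorner {p q T : L} (hp : IsSelfAdjoint p) (hq : IsSelfAdjoint q)
    (hT : T ∈ offCorner p q) : star T ∈ offCorner q p := by
  rw [mem_offCorner] at *
  have := congrArg star hT
  rwa [star_mul, star_mul, star_sub, star_sub, star_one, hp.star_eq, hq.star_eq, star_zero,
    ← mul_assoc] at this

/-- Sums of operators with pairwise orthogonal ranges grow like `√N`. -/
lemma norm_sum_orthogonal_le {p : L} (hp : IsStarProjection p) {v c : ℕ → L} {C : ℝ}
    (hv : ∀ n, v n ∈ unitary L) (horth : ∀ n m, n ≠ m → p * (star (v n) * v m) * p = 0)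
    (hc : ∀ n, ‖c n‖ ≤ C) (N : ℕ) :
    ‖∑ n ∈ Finset.range N, v n * (p * c n)‖ ≤ √N * C := by
  have hC : 0 ≤ C := (norm_nonneg _).trans (hc 0)
  -- Pythagoras: the cross terms contain `p (v n)⋆ v m p = 0`, so only the `N` diagonal terms
  -- survive, and each has norm at most `C ^ 2`.
  have h1 : star (∑ n ∈ Finset.range N, v n * (p * c n)) *
      (∑ n ∈ Finset.range N, v n * (p * c n)) =
      ∑ n ∈ Finset.range N, star (c n) * p * c n := by
    rw [star_sum, Finset.sum_mul_sum]
    refine Finset.sum_congr rfl fun n hn => ?_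
    have h2 : ∀ m, star (v n * (p * c n)) * (v m * (p * c m)) =
        star (c n) * (p * (star (v n) * v m) * p) * c m := fun m => by
      rw [star_mul, star_mul, hp.isSelfAdjoint.star_eq]
      simp only [mul_assoc]
    rw [Finset.sum_eq_single n]
    · rw [h2, (Unitary.mem_iff.mp (hv n)).1, mul_one, hp.isIdempotentElem.eq]
    · intro m _ hm
      rw [h2, horth n m hm.symm, mul_zero, zero_mul]
    · exact fun h => absurd hn h
  have h2 : ‖∑ n ∈ Finset.range N, v n * (p * c n)‖ ^ 2 ≤ N * C ^ 2 := by
    rw [sq, ← CStarRing.norm_star_mul_self, h1]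
    refine (norm_sum_le_of_le (f := fun n => star (c n) * p * c n) (n := fun _ => C ^ 2) _
      fun n _ => ?_).trans_eq (by simp)
    calc ‖star (c n) * p * c n‖ ≤ ‖star (c n)‖ * ‖p‖ * ‖c n‖ :=
          (norm_mul_le _ _).trans (by gcongr; exact norm_mul_le _ _)
      _ ≤ C * 1 * C := by
          rw [norm_star]
          gcongr
          exacts [hc n, hp.norm_le, hc n]
      _ = C ^ 2 := by ring
  refine abs_le_of_sq_le_sq' ?_ (by positivity) |>.2
  rw [mul_pow, Real.sq_sqrt (Nat.cast_nonneg N)]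
  exact h2

/-- The factor `2` comes from cutting `x` into a piece with range in `p` and a piece supported on
`p`. The first is handled by orthogonality of ranges, the second by the same after taking adjoints.
-/
lemma norm_sum_conj_le {p x : L} (hp : IsStarProjection p) (hx : x ∈ offCorner p p)
    {v : ℕ → L} (hv : ∀ n, v n ∈ unitary L)
    (horth : ∀ n m, n ≠ m → p * (star (v n) * v m) * p = 0) (N : ℕ) :
    ‖∑ n ∈ Finset.range N, v n * x * star (v n)‖ ≤ 2 * (√N * ‖x‖) := by
  have hv1 : ∀ n y, ‖y * star (v n)‖ = ‖y‖ := fun n y =>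
    CStarRing.norm_mul_mem_unitary y (Unitary.star_mem (hv n))
  -- Membership in the off-corner says exactly that `(1 - p) x = (1 - p) x p`.
  have hx' : x = p * x + (1 - p) * x * p := by
    have h : (1 - p) * x * (1 - p) = 0 := hx
    rw [mul_sub, mul_one, sub_eq_zero] at h
    rw [← h, sub_mul, one_mul, add_sub_cancel]
  have h1 := norm_sum_orthogonal_le hp hv horth (c := fun n => x * star (v n))
    (fun n => (hv1 n x).le) N
  have hle : ‖star x * (1 - p)‖ ≤ ‖x‖ := by
    refine (norm_mul_le _ _).trans ?_
    rw [norm_star]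
    exact mul_le_of_le_one_right (norm_nonneg _) hp.one_sub.norm_le
  -- The adjoint of `v n (1 - p) x p (v n)⋆` is `v n p (x⋆ (1 - p) (v n)⋆)`, which again has its
  -- range in that of `v n * p`.
  have h2 := norm_sum_orthogonal_le hp hv horth (c := fun n => star x * (1 - p) * star (v n))
    (fun n => (hv1 n _).le.trans hle) N
  rw [← norm_star] at h2
  have h3 : ∑ n ∈ Finset.range N, v n * x * star (v n) =
      ∑ n ∈ Finset.range N, v n * (p * (x * star (v n))) +
      star (∑ n ∈ Finset.range N, v n * (p * (star x * (1 - p) * star (v n)))) := by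
    rw [star_sum, ← Finset.sum_add_distrib]
    refine Finset.sum_congr rfl fun n _ => ?_
    conv_lhs => rw [hx']
    simp only [star_mul, star_sub, star_one, star_star, hp.isSelfAdjoint.star_eq, mul_add, add_mul,
      mul_assoc]
  rw [h3, two_mul]
  exact (norm_add_le _ _).trans (add_le_add h1 h2)

/-- If `‖∑ vₙ x vₙ⋆‖ = O(√N)` for unitaries `vₙ`, then `0` is in the closed convex hull of the unitary
conjugates of `x`. -/
lemma zero_mem_closure_convexHull_conj {x : L} {v : ℕ → L} (hv : ∀ n, v n ∈ unitary L) {C : ℝ}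
    (h : ∀ N : ℕ, ‖∑ n ∈ Finset.range N, v n * x * star (v n)‖ ≤ C * √N) :
    (0 : L) ∈ closure (convexHull ℝ {y | ∃ u ∈ unitary L, y = u * x * star u}) := by
  refine mem_closure_of_tendsto (b := Filter.atTop)
    -- Averaging over `N + 1` terms keeps the weights summing to `1` at `N = 0` too.
    (f := fun N : ℕ => ∑ n ∈ Finset.range (N + 1), ((N + 1 : ℕ) : ℝ)⁻¹ • (v n * x * star (v n)))
    ?_ (Filter.Eventually.of_forall fun N => ?_)
  · refine squeeze_zero_norm (a := fun N : ℕ => C * (√((N + 1 : ℕ) : ℝ))⁻¹) (fun N => ?_) ?_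
    · rw [← Finset.smul_sum, norm_smul, norm_inv, Real.norm_of_nonneg (Nat.cast_nonneg _)]
      have hN : (0 : ℝ) < ((N + 1 : ℕ) : ℝ) := by positivity
      calc _ ≤ (((N + 1 : ℕ) : ℝ))⁻¹ * (C * √((N + 1 : ℕ) : ℝ)) := by gcongr; exact h (N + 1)
        _ = _ := by
          nth_rw 1 [← Real.mul_self_sqrt hN.le]
          have := (Real.sqrt_pos.mpr hN).ne'
          field_simp
    · have h1 : Filter.Tendsto (fun N : ℕ => √((N : ℕ) : ℝ)) Filter.atTop Filter.atTop :=
        Real.tendsto_sqrt_atTop.comp tendsto_natCast_atTop_atTop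
      have h2 := (h1.comp (Filter.tendsto_add_atTop_nat 1)).inv_tendsto_atTop.const_mul C
      rwa [mul_zero] at h2
  · refine (convex_convexHull ℝ _).sum_mem (fun _ _ => by positivity) ?_
      fun n _ => subset_convexHull ℝ _ ⟨v n, hv n, rfl⟩
    rw [Finset.sum_const, Finset.card_range, nsmul_eq_mul]
    exact mul_inv_cancel₀ (by positivity)

/-- With `v n = (b' (a b)ⁿ)⋆`, the operators `(v n)⋆ v m` for `n ≠ m` map the range of `p` to the
range of `q`, which is orthogonal to it. -/
lemma compress_star_mul_eq_zero {p q a b b' : L} (hp : IsStarProjection p)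
    (hq : IsStarProjection q) (hpq : p * q = 0) (ha : a ∈ unitary L) (hb : b ∈ unitary L)
    (ha' : a ∈ offCorner p p) (hb₁ : b ∈ offCorner q q) (hb₁' : b' ∈ offCorner q q)
    (hbb : b * star b' ∈ offCorner q q) (n m : ℕ) (hnm : n ≠ m) :
    p * (star (star (b' * (a * b) ^ n)) * star (b' * (a * b) ^ m)) * p = 0 := by
  have hqp : q * p = 0 := by
    have := congrArg star hpq
    rwa [star_mul, hp.isSelfAdjoint.star_eq, hq.isSelfAdjoint.star_eq, star_zero] at this
  -- Here `b * star b'` counts as one letter, so that the word alternates up to its end.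
  have hpow : ∀ k, (a * b) ^ k * (a * (b * star b')) ∈ offCorner p q := fun k => by
    induction k with
    | zero => rw [pow_zero, one_mul]; exact mul_mem_offCorner hpq ha' hbb
    | succ k ih =>
      rw [pow_succ', mul_assoc]
      exact mul_mem_offCorner hqp (mul_mem_offCorner hpq ha' hb₁) ih
  -- The exponents differ by `k + 1 ≥ 1`: after cancelling `(a * b) ^ m` a factor `a * b` is left,
  -- whose `b` absorbs `star b'`. The leading `b'` makes the range land in `q` rather than in `p`.
  have key : ∀ m k, b' * (a * b) ^ (k + 1 + m) * star (b' * (a * b) ^ m) ∈ offCorner q q := by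
    intro m k
    have hu : (a * b) ^ m * star ((a * b) ^ m) = 1 :=
      (Unitary.mem_iff.mp (pow_mem (mul_mem ha hb) m)).2
    have : b' * (a * b) ^ (k + 1 + m) * star (b' * (a * b) ^ m) =
        b' * ((a * b) ^ k * (a * (b * star b'))) := by
      rw [star_mul, pow_add, pow_succ]
      calc _ = b' * ((a * b) ^ k * (a * b) * ((a * b) ^ m * star ((a * b) ^ m)) * star b') := by
            simp only [mul_assoc]
        _ = _ := by rw [hu]; simp only [mul_one, mul_assoc]
    rw [this]
    exact mul_mem_offCorner hqp hb₁' (hpow k)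
  have hmem : b' * (a * b) ^ n * star (b' * (a * b) ^ m) ∈ offCorner q q := by
    rcases lt_or_gt_of_ne hnm with h | h
    -- For `n < m` the product is the adjoint of the one with `n` and `m` exchanged.
    · obtain ⟨k, rfl⟩ := Nat.exists_eq_add_of_lt h
      have := star_mem_offCorner hq.isSelfAdjoint hq.isSelfAdjoint (key n k)
      rwa [star_mul, star_star, show k + 1 + n = n + k + 1 by ring] at this
    · obtain ⟨k, rfl⟩ := Nat.exists_eq_add_of_lt h
      have := key m k
      rwa [show k + 1 + m = m + k + 1 by ring] at this
  rw [star_star]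
  rw [mem_offCorner] at hmem
  -- Orthogonality of `p` and `q` gives `p = p (1 - q) = (1 - q) p`.
  calc _ = p * (1 - q) * (b' * (a * b) ^ n * star (b' * (a * b) ^ m)) * ((1 - q) * p) := by
        rw [mul_sub, hpq, sub_mul 1 q p, hqp, mul_one, one_mul, sub_zero]
    _ = p * ((1 - q) * (b' * (a * b) ^ n * star (b' * (a * b) ^ m)) * (1 - q)) * p := by
        simp only [mul_assoc]
    _ = 0 := by rw [hmem, mul_zero, zero_mul]

end averaging

/-! ### The projections onto the words which start in a given algebra -/

section startProj

variable {I : Type*} [DecidableEq I] {B : Type*} [CStarAlgebra B] [PartialOrder B]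
  [StarOrderedRing B] {A : I → Type*} [∀ i, CStarAlgebra (A i)] {incl : ∀ i, B →⋆ₐ[ℂ] A i}
  {E : ∀ i, CondExp (incl i)}

/-! ### Start projections before completion -/

namespace PreM

local notation "⟪" x "," y "⟫" => PreHilbertModule.ip (B := B) x y

open PreHilbertModule

open Classical in
/-- The projection onto the span of the reduced words which start with a letter from `A i`. -/
def startProj (i : I) : PreM E →ₗ[ℂ] PreM E where
  toFun v := Finsupp.filter (M := B) (fun p : RWord E => ¬ p.NotStart i) v
  map_add' _ _ := Finsupp.filter_add
  map_smul' _ _ := Finsupp.filter_smul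

lemma startProj_single_of_notStart {i : I} {p : RWord E} (hp : p.NotStart i) (b : B) :
    startProj i (single p b) = 0 := by
  classical exact Finsupp.filter_single_of_neg _ (not_not.mpr hp)

lemma startProj_single {i : I} {p : RWord E} (hp : ¬ p.NotStart i) (b : B) :
    startProj i (single p b) = single p b := by
  classical exact Finsupp.filter_single_of_pos _ hp

lemma startProj_startProj (i : I) (v : PreM E) : startProj i (startProj i v) = startProj i v := by
  induction v using induction with
  | h0 => simp only [map_zero]
  | hadd v w h h' => simp only [map_add, h, h']
  | hs p b =>
    by_cases hp : p.NotStart i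
    · rw [startProj_single_of_notStart hp, map_zero]
    · rw [startProj_single hp, startProj_single hp]

lemma notStart_of_not_notStart {i j : I} (hij : i ≠ j) {p : RWord E} (hp : ¬ p.NotStart j) :
    p.NotStart i := by
  intro x hx
  simp only [RWord.NotStart, not_forall, not_not] at hp
  obtain ⟨y, hy, rfl⟩ := hp
  rw [Option.mem_def] at hx hy
  rw [hx, Option.some_inj] at hy
  rw [hy]
  exact hij.symm

lemma startProj_startProj_of_ne {i j : I} (hij : i ≠ j) (v : PreM E) :
    startProj i (startProj j v) = 0 := by
  induction v using induction with
  | h0 => simp only [map_zero]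
  | hadd v w h h' => simp only [map_add, h, h', add_zero]
  | hs p b =>
    by_cases hp : p.NotStart j
    · rw [startProj_single_of_notStart hp, map_zero]
    · rw [startProj_single hp, startProj_single_of_notStart (notStart_of_not_notStart hij hp)]

/-- The Gram recursion already vanishes at the first letters: either `q` is empty, or its first
letter lies in another algebra. -/
lemma gram_eq_zero_of_start {i : I} {p q : RWord E} (hp : ¬ p.NotStart i) (hq : q.NotStart i)
    (c : B) : gram E p.letters q.letters c = 0 := by
  obtain ⟨_ | ⟨⟨j, a⟩, p⟩, h, h'⟩ := p
  · exact absurd (by simp [RWord.NotStart]) hp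
  · have hj : j = i := by simpa [RWord.NotStart] using hp
    subst hj
    exact gram_cons_notStart a p q hq c

lemma ip_single_eq_zero_of_start {i : I} {p q : RWord E} (hp : ¬ p.NotStart i)
    (hq : q.NotStart i) (b c : B) : ⟪single p b, single q c⟫ = 0 := by
  rw [ip_single, gram_eq_zero_of_start hp hq, mul_zero, zero_mul]

/-- Restricting supports is symmetric because words starting in `A i` are orthogonal to all other
words. This orthogonality is needed since the reduced words are not an orthonormal system for the
form. -/
lemma ip_startProj_left (i : I) (v w : PreM E) : ⟪startProj i v, w⟫ = ⟪v, startProj i w⟫ := by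
  induction w using induction with
  | h0 => rw [map_zero, ip_zero_right, ip_zero_right]
  | hadd w w' h h' => rw [map_add, ip_add_right, ip_add_right, h, h']
  | hs q c =>
  induction v using induction with
  | h0 => rw [map_zero, ← star_ip, ip_zero_right, ← star_ip, ip_zero_right]
  | hadd v v' h h' => rw [map_add, ip_add_left, ip_add_left, h, h']
  | hs p b =>
    by_cases hp : p.NotStart i <;> by_cases hq : q.NotStart i
    · rw [startProj_single_of_notStart hp, startProj_single_of_notStart hq, ip_zero_right,
        ← star_ip, ip_zero_right, star_zero]
    · rw [startProj_single_of_notStart hp, startProj_single hq, ← star_ip, ip_zero_right,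
        ← star_ip, ip_single_eq_zero_of_start hq hp]
    · rw [startProj_single hp, startProj_single_of_notStart hq, ip_zero_right,
        ip_single_eq_zero_of_start hp hq]
    · rw [startProj_single hp, startProj_single hq]

lemma norm_startProj_le (i : I) (v : PreM E) : ‖startProj i v‖ ≤ 1 * ‖v‖ := by
  -- Cauchy-Schwarz applied to `⟨P v, P v⟩ = ⟨P v, v⟩`, with `P` the start projection.
  have h1 : ‖startProj i v‖ * ‖startProj i v‖ ≤ ‖startProj i v‖ * ‖v‖ := by
    have h := ip_cauchy (B := B) (startProj i v) v
    rw [← norm_eq, ← norm_eq] at h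
    refine le_trans (le_of_eq ?_) h
    rw [norm_eq, Real.mul_self_sqrt (norm_nonneg _), ← ip_startProj_left, startProj_startProj]
  rw [one_mul]
  rcases (norm_nonneg (startProj i v)).eq_or_lt with h | h
  · rw [← h]; exact norm_nonneg v
  · exact le_of_mul_le_mul_left h1 h

/-- The projection onto the words which start with a letter from `A i`, as a bounded operator. -/
def startProjCLM (i : I) : PreM E →L[ℂ] PreM E :=
  (startProj i).mkContinuous 1 (norm_startProj_le i)

lemma coef_eq_one {i : I} {p : RWord E} (hp : p.NotStart i) : p.coef i = 1 := by
  obtain ⟨_ | ⟨x, p⟩, h, h'⟩ := p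
  · rfl
  · exact if_neg (hp x (by simp))

/-- Between two words that do not start in `A i`, the matrix coefficient of `a` is their Gram kernel
evaluated at `E i a`, since both have coefficient `1` in `A i`. So it vanishes for centered `a`. -/
lemma ip_sub_startProj_lam {i : I} {a : A i} (ha : E i a = 0) (v w : PreM E) :
    ⟪v - startProj i v, lam i a (w - startProj i w)⟫ = 0 := by
  induction w using induction with
  | h0 => rw [map_zero, sub_zero, map_zero, ip_zero_right]
  | hadd w w' h h' => rw [map_add, add_sub_add_comm, map_add, ip_add_right, h, h', add_zero]
  | hs q c =>
  induction v using induction with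
  | h0 => rw [map_zero, sub_zero, ← star_ip, ip_zero_right, star_zero]
  | hadd v v' h h' => rw [map_add, add_sub_add_comm, ip_add_left, h, h', add_zero]
  | hs p b =>
    by_cases hp : p.NotStart i
    · by_cases hq : q.NotStart i
      · rw [startProj_single_of_notStart hp, startProj_single_of_notStart hq, sub_zero, sub_zero,
          ip_lam, form_single, ker, coef_eq_one hp, coef_eq_one hq, star_one, one_mul, mul_one, ha,
          gram_zero, mul_zero, zero_mul]
      · rw [startProj_single hq, sub_self, map_zero, ip_zero_right]
    · rw [startProj_single hp, sub_self, ← star_ip, ip_zero_right, star_zero]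

end PreM

/-! ### Start projections on the Hilbert module -/

namespace FreeModule

local notation "⟪" x "," y "⟫" => PreHilbertModule.ip (B := B) x y

variable (E) in
/-- The extension of `PreM.startProj` to a bounded operator on `M`. -/
def startM (i : I) : FreeModule E →L[ℂ] FreeModule E :=
  ContinuousLinearMap.completion (PreM.startProjCLM i)

lemma startM_mk (i : I) (v : PreM E) :
    startM E i (HilbertCompletion.mk B v) = HilbertCompletion.mk B (PreM.startProj i v) :=
  ContinuousLinearMap.completion_apply_coe (PreM.startProjCLM i) v

lemma ip_startM (i : I) (x y : FreeModule E) : ⟪startM E i x, y⟫ = ⟪x, startM E i y⟫ := by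
  induction x using HilbertCompletion.induction with
  | hc => exact isClosed_eq (continuous_ip (startM E i).continuous continuous_const)
           (continuous_ip continuous_id continuous_const)
  | h v =>
  induction y using HilbertCompletion.induction with
  | hc => exact isClosed_eq (continuous_ip continuous_const continuous_id)
           (continuous_ip continuous_const (startM E i).continuous)
  | h w =>
    rw [startM_mk, startM_mk, HilbertCompletion.ip_mk, HilbertCompletion.ip_mk,
      PreM.ip_startProj_left]

end FreeModule

open FreeModule

variable (E) in
/-- The projection of `M` onto the closed span of the reduced words which start in `A i`. -/
def start (i : I) : Adjointable B (FreeModule E) := ⟨startM E i, startM E i, ip_startM i⟩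

lemma isStarProjection_start (i : I) : IsStarProjection (start E i) where
  isIdempotentElem := Subtype.ext <| clm_ext fun v w => by
    change PreHilbertModule.ip _ (startM E i (startM E i _)) =
      PreHilbertModule.ip _ (startM E i _)
    rw [startM_mk, startM_mk, PreM.startProj_startProj]
  isSelfAdjoint := Subtype.ext (Adjointable.adj_eq (ip_startM i))

lemma start_mul_start {i j : I} (hij : i ≠ j) : start E i * start E j = 0 :=
  Subtype.ext <| clm_ext fun v w => by
    change PreHilbertModule.ip _ (startM E i (startM E j _)) =
      PreHilbertModule.ip _ (0 : FreeModule E)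
    rw [startM_mk, startM_mk, PreM.startProj_startProj_of_ne hij, ip_zero_right,
      HilbertCompletion.ip_mk, ip_zero_right]

lemma lambda_mem_offCorner {i : I} {a : A i} (ha : E i a = 0) :
    lambda E i a ∈ offCorner (start E i) (start E i) := by
  rw [mem_offCorner]
  refine Subtype.ext <| clm_ext fun v w => ?_
  change PreHilbertModule.ip _ (lamM i a (HilbertCompletion.mk B w - startM E i _) -
    startM E i (lamM i a (HilbertCompletion.mk B w - startM E i _))) =
    PreHilbertModule.ip _ (0 : FreeModule E)
  have hsub : ∀ u : PreM E, HilbertCompletion.mk B u - startM E i (HilbertCompletion.mk B u) =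
      HilbertCompletion.mk B (u - PreM.startProj i u) := fun u => by
    rw [startM_mk, sub_eq_iff_eq_add, ← HilbertCompletion.mk_add, sub_add_cancel]
  -- Self-adjointness moves the outer complementary projection to the left vector, which reduces the
  -- claim to the algebraic computation.
  rw [hsub, lamM_mk, hsub, HilbertCompletion.ip_mk, ip_zero_right, ip_sub_right,
    ← PreM.ip_startProj_left, ← ip_sub_left, PreM.ip_sub_startProj_lam ha]

/-! ### Averaging in the reduced free product -/

namespace ReducedFreeProduct

variable (E) in
/-- The inclusion of the reduced amalgamated free product into the adjointable operators. -/
def toAdjointable : ReducedFreeProduct E →⋆ₐ[ℂ] Adjointable B (FreeModule E) :=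
  (freeProdAlgebra E).subtype

lemma norm_toAdjointable (x : ReducedFreeProduct E) : ‖toAdjointable E x‖ = ‖x‖ := rfl

lemma toAdjointable_mem_unitary {u : ReducedFreeProduct E} (hu : u ∈ unitary _) :
    toAdjointable E u ∈ unitary _ := Unitary.map_mem (toAdjointable E) hu

/-- The empty word has coefficient `1` and empty rest, so its matrix coefficient for `a` is `E i a`.
-/
lemma expect_of (i : I) (a : A i) : expect E (of E i a) = E i a := by
  change PreHilbertModule.ip (HilbertCompletion.mk B _) (lamM i a (HilbertCompletion.mk B _)) = _
  rw [lamM_mk, HilbertCompletion.ip_mk, PreM.ip_lam, PreM.form_single]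
  simp [PreM.ker, RWord.nil, RWord.rest, RWord.coef, gram]

/-- The off-corner is a linear subspace, so single words suffice. Each induction step appends a
letter from `A j°` and one from `A i°`, and the composition rule applies at both junctions. -/
lemma toAdjointable_mem_of_mem_altSpan {i j : I} (hij : i ≠ j) {x : ReducedFreeProduct E}
    (hx : x ∈ altSpan E i j) : toAdjointable E x ∈ offCorner (start E i) (start E i) := by
  suffices h : altSpan E i j ≤ (offCorner (start E i) (start E i)).comap
      (toAdjointable E).toAlgHom.toLinearMap from h hx
  refine Submodule.span_le.mpr (Set.iUnion_subset fun k => ?_)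
  induction k with
  | zero =>
    rw [pow_zero, mul_one]
    rintro _ ⟨a, ha, rfl⟩
    exact lambda_mem_offCorner ha
  | succ k ih =>
    rw [pow_succ, ← mul_assoc]
    rintro _ ⟨y, hy, _, ⟨_, ⟨b, hb, rfl⟩, _, ⟨a, ha, rfl⟩, rfl⟩, rfl⟩
    change toAdjointable E (y * (of E j b * of E i a)) ∈ offCorner (start E i) (start E i)
    rw [map_mul, map_mul]
    exact mul_mem_offCorner (start_mul_start hij) (ih hy)
      (mul_mem_offCorner (start_mul_start hij.symm) (lambda_mem_offCorner hb)
        (lambda_mem_offCorner ha))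

lemma of_mem_offCorner {i : I} {a : A i} (ha : E i a = 0) :
    toAdjointable E (of E i a) ∈ offCorner (start E i) (start E i) := lambda_mem_offCorner ha

/-- Transfers the operator estimate to the free product through the isometric inclusion into the
adjointable operators, where the start projections live. -/
lemma norm_sum_conj_altSpan_le {i j : I} (hij : i ≠ j) {a : A i} {b b' : A j}
    (ha : a ∈ unitary (A i)) (hb : b ∈ unitary (A j)) (hb' : b' ∈ unitary (A j))
    (ha₀ : E i a = 0) (hb₀ : E j b = 0) (hb₀' : E j b' = 0) (hbb : E j (b * star b') = 0)
    {x : ReducedFreeProduct E} (hx : x ∈ altSpan E i j) {v : ℕ → ReducedFreeProduct E}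
    (hv : ∀ n, v n = star (of E j b' * (of E i a * of E j b) ^ n)) (N : ℕ) :
    (∀ n, v n ∈ unitary (ReducedFreeProduct E)) ∧
      ‖∑ n ∈ Finset.range N, v n * x * star (v n)‖ ≤ 2 * (√N * ‖x‖) := by
  have hof : ∀ l, ∀ u ∈ unitary (A l), of E l u ∈ unitary (ReducedFreeProduct E) :=
    fun l u hu => Unitary.map_mem (of E l) hu
  have hvu : ∀ n, v n ∈ unitary (ReducedFreeProduct E) := fun n => by
    rw [hv]
    exact Unitary.star_mem (mul_mem (hof _ _ hb') (pow_mem (mul_mem (hof _ _ ha) (hof _ _ hb)) n))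
  refine ⟨hvu, ?_⟩
  have hbb' := of_mem_offCorner hbb
  rw [map_mul, map_star, map_mul, map_star] at hbb'
  have horth := compress_star_mul_eq_zero (L := Adjointable B (FreeModule E))
    (a := toAdjointable E (of E i a)) (b := toAdjointable E (of E j b))
    (b' := toAdjointable E (of E j b')) (isStarProjection_start i) (isStarProjection_start j)
    (start_mul_start hij) (toAdjointable_mem_unitary (hof _ _ ha))
    (toAdjointable_mem_unitary (hof _ _ hb)) (of_mem_offCorner ha₀) (of_mem_offCorner hb₀)
    (of_mem_offCorner hb₀') hbb'
  have key := norm_sum_conj_le (L := Adjointable B (FreeModule E)) (isStarProjection_start i)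
    (x := toAdjointable E x) (toAdjointable_mem_of_mem_altSpan hij hx)
    (v := fun n => toAdjointable E (v n)) (fun n => toAdjointable_mem_unitary (hvu n))
    (fun n m hnm => by
      rw [hv, hv, map_star, map_mul, map_pow, map_mul, map_star, map_mul, map_pow, map_mul]
      exact horth n m hnm) N
  calc ‖∑ n ∈ Finset.range N, v n * x * star (v n)‖
      = ‖∑ n ∈ Finset.range N, toAdjointable E (v n) * toAdjointable E x *
          star (toAdjointable E (v n))‖ := by
        rw [← norm_toAdjointable, map_sum]
        simp only [map_mul, map_star]
    _ ≤ 2 * (√N * ‖x‖) := by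
        rw [← norm_toAdjointable x]
        exact key

/-- If the Avitzour condition holds, then `0` is in the closed convex hull of the unitary conjugates
of every element of `altSpan E i j`. -/
theorem zero_mem_closure_convexHull_conj_of_mem_altSpan {i j : I} (hij : i ≠ j) {a : A i}
    {b b' : A j} (ha : a ∈ unitary (A i)) (hb : b ∈ unitary (A j)) (hb' : b' ∈ unitary (A j))
    (ha₀ : E i a = 0) (hb₀ : E j b = 0) (hb₀' : E j b' = 0) (hbb : E j (b * star b') = 0)
    {x : ReducedFreeProduct E} (hx : x ∈ altSpan E i j) :
    (0 : ReducedFreeProduct E) ∈ closure (convexHull ℝ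
      {y | ∃ u ∈ unitary (ReducedFreeProduct E), y = u * x * star u}) := by
  have h := norm_sum_conj_altSpan_le hij ha hb hb' ha₀ hb₀ hb₀' hbb hx (fun _ => rfl)
  refine zero_mem_closure_convexHull_conj (h 0).1 (C := 2 * ‖x‖) fun N => (h N).2.trans_eq ?_
  ring

end ReducedFreeProduct

end startProj

end AmalgFree

end

/-- Let `A 0`, `A 1` be unital C⋆-algebras containing the unital C⋆-algebra `B`, with conditional
expectations `E 0`, `E 1` onto `B` whose KSGNS representations are faithful, and with reduced
amalgamated free product `(𝔄, E)`. If the Avitzour condition holds for `u₁ ∈ A 0` and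
`u₂, u₂' ∈ A 1`, then `0` is in the norm closed convex hull of the unitary conjugates of every `x` in
the span of the alternating words which begin and end with a letter from the kernel of `E 0`. -/
theorem mainTheorem8 {B : Type*} [CStarAlgebra B] [PartialOrder B] [StarOrderedRing B]
    {A : Fin 2 → Type*} [∀ i, CStarAlgebra (A i)] (incl : ∀ i, B →⋆ₐ[ℂ] A i)
    (E : ∀ i, AmalgFree.CondExp (incl i)) (hE : ∀ i, (E i).Nondegenerate)
    (u₁ : A 0) (u₂ u₂' : A 1) (hu₁ : u₁ ∈ unitary (A 0)) (hu₂ : u₂ ∈ unitary (A 1))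
    (hu₂' : u₂' ∈ unitary (A 1)) (h₁ : E 0 u₁ = 0) (h₂ : E 1 u₂ = 0) (h₂' : E 1 u₂' = 0)
    (h₂₂' : AmalgFree.ReducedFreeProduct.expect E
      (AmalgFree.ReducedFreeProduct.of E 1 u₂ *
        star (AmalgFree.ReducedFreeProduct.of E 1 u₂')) = 0)
    (x : AmalgFree.ReducedFreeProduct E)
    (hx : x ∈ AmalgFree.ReducedFreeProduct.altSpan E 0 1) :
    (0 : AmalgFree.ReducedFreeProduct E) ∈ closure (convexHull ℝ
      {y | ∃ u ∈ unitary (AmalgFree.ReducedFreeProduct E), y = u * x * star u}) := by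
  refine AmalgFree.ReducedFreeProduct.zero_mem_closure_convexHull_conj_of_mem_altSpan
    (by decide) hu₁ hu₂ hu₂' h₁ h₂ h₂' ?_ hx
  -- The condition on `u₂ u₂'⋆` is given for the expectation of the free product, which restricts to
  -- `E 1` on `A 1`.
  rw [← AmalgFree.ReducedFreeProduct.expect_of, map_mul, map_star, h₂₂']
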